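/- Let $p_1,p_2,s_1,s_2\in\mathbb R$ and consider the polar system $$\dot r=2rp_1+2r^2\bigl(s_1-\cos(12\theta)\bigr),\qquad \dot\theta=p_2+r\bigl(s_2+\sin(12\theta)\bigr),$$ as a vector field on the plane with $z=\sqrt r\,e^{i\theta}$, $r\ge 0$, that is, $\dot z=\bigl(\tfrac{\dot r}{2r}+i\dot\theta\bigr)z$ for $z\neq0$ and $\dot z=0$ at the origin $z=0$. Put $$\mathcal Q(p_1,p_2)=p_1^2+p_2^2-(p_1s_2-p_2s_1)^2=(1-s_2^2)p_1^2+(1-s_1^2)p_2^2+2s_1s_2p_1p_2 .$$ A critical point is called a saddle if its Jacobian has one negative and one positive eigenvalue. It is called a saddle-node if its Jacobian $J$ has a zero and a nonzero eigenvalue and $w\cdot D^2V(v,v)\ne0$, where $V$ is the vector field, $Jv=0$, $w^{T}J=0$, $v,w\neq0$. The index is the Poincaré index (the winding number of the field along small circles around the point). Suppose $s_2>1$. If $p_2\ge 0$, the origin is the only critical point. If $p_2<0$, then: 1. if $\mathcal Q(p_1,p_2)<0$, the origin is the only critical point; 2. if $\mathcal Q(p_1,p_2)=0$, there are exactly $13$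 critical points: the origin and twelve others, exactly one in each sector $\alpha\le\theta<\alpha+2\pi/12$ ($\alpha\in\mathbb R$). Each of the twelve has $0$ as an eigenvalue of its Jacobian and has index $0$, and each is a saddle-node if and only if $p_1^2s_1+6p_2^2s_1-5p_1p_2s_2\neq0$; 3. if $\mathcal Q(p_1,p_2)>0$, there are exactly $25$ critical points: the origin, twelve saddles and twelve points of index $+1$, with exactly one saddle and exactly one point of index $+1$ in each sector $\alpha\le\theta<\alpha+2\pi/12$ ($\alpha\in\mathbb R$). If $s_2<-1$, the same holds with $p_2\ge0$ replaced by $p_2\le0$ and $p_2<0$ replaced by $p_2>0$. -/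

import Mathlib

noncomputable section

/-- Right-hand side `ṙ` of the polar system. -/
def polarR (p₁ s₁ r θ : ℝ) : ℝ :=
  2 * r * p₁ + 2 * r ^ 2 * (s₁ - Real.cos (12 * θ))

/-- Right-hand side `θ̇` of the polar system. -/
def polarTheta (p₂ s₂ r θ : ℝ) : ℝ :=
  p₂ + r * (s₂ + Real.sin (12 * θ))

/-- The polar system as a vector field on its phase plane `ℂ`, where `z = √r e^{iθ}`.
Differentiating `z = √r e^{iθ}` gives `ż = (ṙ / (2 r) + i θ̇) z`, with `r = |z|²` and `θ = arg z`;
the value at `z = 0` is `0`, which is also the limit there. -/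
def planarField (p₁ p₂ s₁ s₂ : ℝ) (z : ℂ) : ℂ :=
  (((polarR p₁ s₁ (‖z‖ ^ 2) z.arg / (2 * ‖z‖ ^ 2) : ℝ) : ℂ) +
    ((polarTheta p₂ s₂ (‖z‖ ^ 2) z.arg : ℝ) : ℂ) * Complex.I) * z

/-- The critical points of the polar system in its phase plane. -/
def criticalPoints (p₁ p₂ s₁ s₂ : ℝ) : Set ℂ :=
  {z | planarField p₁ p₂ s₁ s₂ z = 0}

/-- The quadratic form `Q`. -/
def quadForm (s₁ s₂ p₁ p₂ : ℝ) : ℝ :=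
  p₁ ^ 2 + p₂ ^ 2 - (p₁ * s₂ - p₂ * s₁) ^ 2

/-- The sector `α ≤ θ < α + 2π/12`, which is one twelfth of the punctured phase plane. -/
def sector (α : ℝ) : Set ℂ :=
  {z | ∃ ρ θ : ℝ, 0 < ρ ∧ α ≤ θ ∧ θ < α + 2 * Real.pi / 12 ∧
    z = (ρ : ℂ) * Complex.exp ((θ : ℂ) * Complex.I)}

/-- The real number `μ` is an eigenvalue of the (real) Jacobian of `V` at `z₀`. -/
def IsJacobianEigenvalue (V : ℂ → ℂ) (z₀ : ℂ) (μ : ℝ) : Prop :=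
  Module.End.HasEigenvalue ((fderiv ℝ V z₀ : ℂ →L[ℝ] ℂ) : ℂ →ₗ[ℝ] ℂ) μ

/-- A (hyperbolic) saddle: a critical point whose Jacobian has one negative and one positive
real eigenvalue. -/
def IsSaddle (V : ℂ → ℂ) (z₀ : ℂ) : Prop :=
  V z₀ = 0 ∧ DifferentiableAt ℝ V z₀ ∧
    ∃ a b : ℝ, a < 0 ∧ 0 < b ∧ IsJacobianEigenvalue V z₀ a ∧ IsJacobianEigenvalue V z₀ b

/-- A saddle-node: a critical point that is semi-hyperbolic (the Jacobian has a zero and a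
nonzero eigenvalue) and at which the quadratic term of the flow along the kernel direction does
not vanish: with `v` and `w` a right and a left null vector of the Jacobian,
`w (D²V(z₀)(v, v)) ≠ 0`. -/
def IsSaddleNode (V : ℂ → ℂ) (z₀ : ℂ) : Prop :=
  V z₀ = 0 ∧ ContDiffAt ℝ 2 V z₀ ∧
    (∃ μ : ℝ, μ ≠ 0 ∧ IsJacobianEigenvalue V z₀ μ) ∧
    ∃ (v : ℂ) (w : ℂ →L[ℝ] ℝ), v ≠ 0 ∧ w ≠ 0 ∧
      fderiv ℝ V z₀ v = 0 ∧ (∀ x : ℂ, w (fderiv ℝ V z₀ x) = 0) ∧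
      iteratedDeriv 2 (fun t : ℝ => w (V (z₀ + (t : ℂ) * v))) 0 ≠ 0

/-- `z₀` is an isolated critical point of `V` of Poincaré index `n`: on every sufficiently small
circle around `z₀`, the field `V` has no zero and its argument, followed continuously once around
the circle counterclockwise, increases by `2πn`. -/
def HasPoincareIndex (V : ℂ → ℂ) (z₀ : ℂ) (n : ℤ) : Prop :=
  V z₀ = 0 ∧ ∃ ε : ℝ, 0 < ε ∧ ∀ ρ : ℝ, 0 < ρ → ρ < ε →
    ∃ φ : ℝ → ℝ, ContinuousOn φ (Set.Icc 0 (2 * Real.pi)) ∧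
      (∀ t ∈ Set.Icc (0 : ℝ) (2 * Real.pi),
        V (z₀ + (ρ : ℂ) * Complex.exp ((t : ℂ) * Complex.I)) ≠ 0 ∧
        V (z₀ + (ρ : ℂ) * Complex.exp ((t : ℂ) * Complex.I)) =
          (‖V (z₀ + (ρ : ℂ) * Complex.exp ((t : ℂ) * Complex.I))‖ : ℂ) *
            Complex.exp ((φ t : ℂ) * Complex.I)) ∧
      φ (2 * Real.pi) - φ 0 = 2 * Real.pi * n

end

/-!
In the coordinate `z` the field is `z (p + |z|² (s - u(z)))`, where `p = p₁ + i p₂`, `s = s₁ + i s₂`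
and `u(z) = e^{-12iθ}` is unimodular. With `t = |z|⁻²`, a point `z ≠ 0` is critical if and only if
`u(z) = s + t p`. Hence every `t > 0` with `|s + t p| = 1` contributes a ring of twelve critical
points, the solutions of `z¹² = const`, and there are no others. As `|s| > 1`, the ray `s + t p`
misses the unit circle, touches it or crosses it twice. It can only meet the circle if it starts
inwards, that is, if `Re (p̄ s) < 0`, and then the sign of `Q` distinguishes the three cases.

At a critical point the Jacobian determinant is a positive multiple of `Re (s ū) - 1`, which is
`-t/2` times the derivative of `|s + t p|²`. So where the ray enters the disc the index is `+1`, and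
where it leaves the disc there is a saddle.

At a point `z₀` of tangency, `Re (s ū₀) = 1` for `u₀ = u(z₀)`. Dividing the field by `z u₀`, which
does not change the index at `z₀`, gives `|z₀|² (1 - s ū₀) + |z|² (s ū₀ - u(z) ū₀)`. This has
nonnegative real part because `Re (u(z) ū₀) ≤ 1`, and it vanishes only at critical points, so it
never meets the negative real axis near `z₀`, and the index is `0`.
-/

open Complex Filter Topology ComplexConjugate
open scoped Real

section WindingNumber

/-- The continuous argument of the curve `γ`, followed over the parameter interval `[0, 2π]`,
increases by `2πn`. The curve is not required to be closed. -/
def HasWindingNumber (γ : ℝ → ℂ) (n : ℤ) : Prop :=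
  ∃ φ : ℝ → ℝ, ContinuousOn φ (Set.Icc 0 (2 * π)) ∧
    (∀ t ∈ Set.Icc (0 : ℝ) (2 * π), γ t ≠ 0 ∧ γ t = (‖γ t‖ : ℂ) * exp ((φ t : ℂ) * I)) ∧
    φ (2 * π) - φ 0 = 2 * π * n

variable {γ δ : ℝ → ℂ} {m n : ℤ}

theorem HasWindingNumber.unique (hm : HasWindingNumber γ m) (hn : HasWindingNumber γ n) :
    m = n := by
  obtain ⟨φ, hφc, hφ, hφe⟩ := hm
  obtain ⟨ψ, hψc, hψ, hψe⟩ := hn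
  have exp_sub_eq_one : ∀ t ∈ Set.Icc (0 : ℝ) (2 * π), Circle.exp (φ t - ψ t) = 1 := by
    intro t ht
    rw [Circle.exp_sub, div_eq_one, Circle.ext_iff, Circle.coe_exp, Circle.coe_exp]
    refine mul_left_cancel₀ ?_ ((hφ t ht).2.symm.trans (hψ t ht).2)
    exact ofReal_ne_zero.2 (norm_ne_zero_iff.2 (hφ t ht).1)
  have h0 : (0 : ℝ) ∈ Set.Icc 0 (2 * π) := Set.left_mem_Icc.2 Real.two_pi_pos.le
  have h2π : 2 * π ∈ Set.Icc 0 (2 * π) := Set.right_mem_Icc.2 Real.two_pi_pos.le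
  have sub_eq : φ (2 * π) - ψ (2 * π) = φ 0 - ψ 0 :=
    Circle.isCoveringMap_exp.eqOn_of_comp_eqOn isPreconnected_Icc (hφc.sub hψc)
      continuousOn_const (fun t ht => (exp_sub_eq_one t ht).trans (exp_sub_eq_one 0 h0).symm) h0 rfl
      h2π
  have h : 2 * π * (m : ℝ) = 2 * π * n := by linarith
  exact_mod_cast mul_left_cancel₀ Real.two_pi_pos.ne' h

theorem HasWindingNumber.mul (hγ : HasWindingNumber γ m) (hδ : HasWindingNumber δ n) :
    HasWindingNumber (fun t => γ t * δ t) (m + n) := by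
  obtain ⟨φ, hφc, hφ, hφe⟩ := hγ
  obtain ⟨ψ, hψc, hψ, hψe⟩ := hδ
  refine ⟨fun t => φ t + ψ t, hφc.add hψc, fun t ht => ⟨mul_ne_zero (hφ t ht).1 (hψ t ht).1, ?_⟩,
    by push_cast; linarith⟩
  change γ t * δ t = _
  conv_lhs => rw [(hφ t ht).2, (hψ t ht).2]
  rw [norm_mul, ofReal_mul, ofReal_add, add_mul, exp_add]
  ring

theorem HasWindingNumber.congr (hγ : HasWindingNumber γ n)
    (h : Set.EqOn γ δ (Set.Icc 0 (2 * π))) : HasWindingNumber δ n := by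
  obtain ⟨φ, hφc, hφ, hφe⟩ := hγ
  exact ⟨φ, hφc, fun t ht => h ht ▸ hφ t ht, hφe⟩

theorem hasWindingNumber_mul_exp {c : ℂ} (hc : c ≠ 0) (n : ℤ) :
    HasWindingNumber (fun t => c * exp (n * t * I)) n := by
  refine ⟨fun t => c.arg + n * t, by fun_prop, fun t _ => ⟨mul_ne_zero hc (exp_ne_zero _), ?_⟩,
    by ring⟩
  have norm_exp : ‖exp (n * t * I)‖ = 1 := mod_cast norm_exp_ofReal_mul_I (n * t)
  change c * exp (n * t * I) = _
  conv_lhs => rw [← norm_mul_exp_arg_mul_I c]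
  rw [norm_mul, norm_exp, mul_one, mul_assoc, ← exp_add]
  push_cast
  ring_nf

theorem hasWindingNumber_zero_of_mem_slitPlane (hγ : ContinuousOn γ (Set.Icc 0 (2 * π)))
    (hper : γ (2 * π) = γ 0) (h : ∀ t ∈ Set.Icc 0 (2 * π), γ t ∈ slitPlane) :
    HasWindingNumber γ 0 :=
  ⟨fun t => (γ t).arg, fun t ht => (continuousAt_arg (h t ht)).comp_continuousWithinAt (hγ t ht),
    fun t ht => ⟨slitPlane_ne_zero (h t ht), (norm_mul_exp_arg_mul_I _).symm⟩, by simp [hper]⟩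

theorem HasWindingNumber.of_norm_sub_lt (hδ : HasWindingNumber δ n)
    (hγc : ContinuousOn γ (Set.Icc 0 (2 * π))) (hδc : ContinuousOn δ (Set.Icc 0 (2 * π)))
    (hγper : γ (2 * π) = γ 0) (hδper : δ (2 * π) = δ 0)
    (hlt : ∀ t ∈ Set.Icc 0 (2 * π), ‖γ t - δ t‖ < ‖δ t‖) : HasWindingNumber γ n := by
  have hδ0 : ∀ t ∈ Set.Icc 0 (2 * π), δ t ≠ 0 := fun t ht =>
    norm_pos_iff.1 ((norm_nonneg _).trans_lt (hlt t ht))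
  have hquot : HasWindingNumber (fun t => γ t / δ t) 0 := by
    refine hasWindingNumber_zero_of_mem_slitPlane (hγc.div hδc hδ0) (by rw [hγper, hδper])
      fun t ht => ?_
    have norm_lt : ‖(γ t - δ t) / δ t‖ < 1 := by
      rw [norm_div, div_lt_one (norm_pos_iff.2 (hδ0 t ht))]
      exact hlt t ht
    simpa [sub_div, hδ0 t ht] using mem_slitPlane_of_norm_lt_one norm_lt
  simpa only [add_zero] using (hδ.mul hquot).congr fun t ht => mul_div_cancel₀ _ (hδ0 t ht)

end WindingNumber

section PoincareIndex

variable {V : ℂ → ℂ} {z₀ : ℂ} {m n : ℤ}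

theorem hasPoincareIndex_iff :
    HasPoincareIndex V z₀ n ↔
      V z₀ = 0 ∧ ∀ᶠ ρ in 𝓝[>] (0 : ℝ), HasWindingNumber (fun t => V (circleMap z₀ ρ t)) n :=
  and_congr_right fun _ =>
    ⟨fun ⟨ε, hε, h⟩ => mem_nhdsGT_iff_exists_Ioo_subset.2 ⟨ε, hε, fun ρ hρ => h ρ hρ.1 hρ.2⟩,
      fun h => (mem_nhdsGT_iff_exists_Ioo_subset.1 h).imp fun _ ⟨hε, h⟩ =>
        ⟨hε, fun _ hρ hlt => h ⟨hρ, hlt⟩⟩⟩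

theorem HasPoincareIndex.unique (hm : HasPoincareIndex V z₀ m) (hn : HasPoincareIndex V z₀ n) :
    m = n := by
  obtain ⟨ρ, h₁, h₂⟩ := ((hasPoincareIndex_iff.1 hm).2.and (hasPoincareIndex_iff.1 hn).2).exists
  exact h₁.unique h₂

theorem eventually_forall_circleMap {P : ℂ → Prop} (h : ∀ᶠ z in 𝓝[≠] z₀, P z) :
    ∀ᶠ ρ in 𝓝[>] (0 : ℝ), ∀ t, P (circleMap z₀ ρ t) := by
  obtain ⟨ε, hε, hball⟩ := Metric.eventually_nhds_iff.1 (eventually_nhdsWithin_iff.1 h)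
  filter_upwards [Ioo_mem_nhdsGT hε] with ρ ⟨hρ, hlt⟩ t
  refine hball ?_ (circleMap_ne_center hρ.ne')
  rwa [dist_eq_norm, circleMap_sub_center, norm_circleMap_zero, abs_of_pos hρ]

theorem eventually_continuous_comp_circleMap (hV : ∀ᶠ z in 𝓝[≠] z₀, ContinuousAt V z) :
    ∀ᶠ ρ in 𝓝[>] (0 : ℝ), Continuous fun t => V (circleMap z₀ ρ t) := by
  filter_upwards [eventually_forall_circleMap hV] with ρ hρ
  exact continuous_iff_continuousAt.2 fun t =>
    ContinuousAt.comp (f := circleMap z₀ ρ) (hρ t) (continuous_circleMap z₀ ρ).continuousAt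

theorem comp_circleMap_two_pi (V : ℂ → ℂ) (z₀ : ℂ) (ρ : ℝ) :
    V (circleMap z₀ ρ (2 * π)) = V (circleMap z₀ ρ 0) := by
  rw [(periodic_circleMap z₀ ρ).eq]

theorem hasPoincareIndex_zero_of_mem_slitPlane (h₀ : V z₀ = 0)
    (hV : ∀ᶠ z in 𝓝[≠] z₀, ContinuousAt V z) (h : ∀ᶠ z in 𝓝[≠] z₀, V z ∈ slitPlane) :
    HasPoincareIndex V z₀ 0 := by
  refine hasPoincareIndex_iff.2 ⟨h₀, ?_⟩
  filter_upwards [eventually_continuous_comp_circleMap hV, eventually_forall_circleMap h]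
    with ρ hcont hmem
  exact hasWindingNumber_zero_of_mem_slitPlane hcont.continuousOn
    (comp_circleMap_two_pi V z₀ ρ) fun t _ => hmem t

theorem HasPoincareIndex.mul_left {f : ℂ → ℂ} (hV : HasPoincareIndex V z₀ n)
    (hf : ∀ᶠ z in 𝓝 z₀, ContinuousAt f z) (hf₀ : f z₀ ≠ 0) :
    HasPoincareIndex (fun z => f z * V z) z₀ n := by
  obtain ⟨hV₀, hV⟩ := hasPoincareIndex_iff.1 hV
  refine hasPoincareIndex_iff.2 ⟨by rw [hV₀, mul_zero], ?_⟩
  have near : ∀ᶠ z in 𝓝 z₀, ‖f z - f z₀‖ < ‖f z₀‖ := by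
    simpa [dist_eq_norm] using
      hf.self_of_nhds.eventually (Metric.ball_mem_nhds _ (norm_pos_iff.2 hf₀))
  have winding_const : HasWindingNumber (fun _ => f z₀) 0 := by
    simpa using hasWindingNumber_mul_exp hf₀ 0
  filter_upwards [hV, eventually_continuous_comp_circleMap (hf.filter_mono nhdsWithin_le_nhds),
    eventually_forall_circleMap (near.filter_mono nhdsWithin_le_nhds)] with ρ hρ hcont hlt
  have winding_f := winding_const.of_norm_sub_lt hcont.continuousOn continuousOn_const
    (comp_circleMap_two_pi f z₀ ρ) rfl fun t _ => hlt t
  simpa only [zero_add] using winding_f.mul hρ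

theorem HasPoincareIndex.congr {W : ℂ → ℂ} (hV : HasPoincareIndex V z₀ n) (h : V =ᶠ[𝓝 z₀] W) :
    HasPoincareIndex W z₀ n := by
  obtain ⟨hV₀, hV⟩ := hasPoincareIndex_iff.1 hV
  refine hasPoincareIndex_iff.2 ⟨h.self_of_nhds ▸ hV₀, ?_⟩
  filter_upwards [hV, eventually_forall_circleMap (h.filter_mono nhdsWithin_le_nhds)] with ρ hρ heq
  exact hρ.congr fun t _ => heq t

end PoincareIndex

section LinearPart

/-- The real-linear map `x ↦ A x + B x̄` of the plane, whose trace is `2 Re A` and whose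
determinant is `|A|² - |B|²`. Every Jacobian below is written in this form. -/
noncomputable def wirtingerMap (A B : ℂ) : ℂ →L[ℝ] ℂ :=
  A • ContinuousLinearMap.id ℝ ℂ + B • (conjCLE : ℂ →L[ℝ] ℂ)

@[simp]
theorem wirtingerMap_apply (A B x : ℂ) : wirtingerMap A B x = A * x + B * conj x := rfl

variable {V : ℂ → ℂ} {z₀ A B : ℂ}

theorem hasPoincareIndex_of_norm_fderiv_sub_le {L M : ℂ →L[ℝ] ℂ} {n : ℤ} {η : ℝ} (hη : 0 < η)
    (h₀ : V z₀ = 0) (hV : ∀ᶠ z in 𝓝[≠] z₀, ContinuousAt V z) (hd : HasFDerivAt V L z₀)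
    (hM : ∀ ρ > 0, HasWindingNumber (fun t => M (circleMap 0 ρ t)) n)
    (hLM : ∀ x, ‖L x - M x‖ + η * ‖x‖ ≤ ‖M x‖) : HasPoincareIndex V z₀ n := by
  refine hasPoincareIndex_iff.2 ⟨h₀, ?_⟩
  have near : ∀ᶠ z in 𝓝[≠] z₀, ‖V z - L (z - z₀)‖ < η * ‖z - z₀‖ := by
    filter_upwards [nhdsWithin_le_nhds ((hasFDerivAt_iff_isLittleO.1 hd).def (half_pos hη)),
      self_mem_nhdsWithin] with z hz hne
    rw [h₀, sub_zero] at hz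
    refine hz.trans_lt (mul_lt_mul_of_pos_right (half_lt_self hη) ?_)
    exact norm_pos_iff.2 (sub_ne_zero.2 hne)
  filter_upwards [eventually_continuous_comp_circleMap hV, eventually_forall_circleMap near,
    self_mem_nhdsWithin] with ρ hcont hnear hρ
  refine (hM ρ hρ).of_norm_sub_lt hcont.continuousOn (by fun_prop)
    (comp_circleMap_two_pi V z₀ ρ) (comp_circleMap_two_pi M 0 ρ) fun t _ => ?_
  have hlin := hnear t
  rw [circleMap_sub_center] at hlin
  linarith [norm_sub_le_norm_sub_add_norm_sub (V (circleMap z₀ ρ t)) (L (circleMap 0 ρ t))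
    (M (circleMap 0 ρ t)), hLM (circleMap 0 ρ t)]

theorem hasPoincareIndex_one (h₀ : V z₀ = 0) (hV : ∀ᶠ z in 𝓝[≠] z₀, ContinuousAt V z)
    (hd : HasFDerivAt V (wirtingerMap A B) z₀) (hBA : ‖B‖ < ‖A‖) : HasPoincareIndex V z₀ 1 := by
  have hA : A ≠ 0 := norm_pos_iff.1 ((norm_nonneg B).trans_lt hBA)
  refine hasPoincareIndex_of_norm_fderiv_sub_le (M := wirtingerMap A 0) (sub_pos.2 hBA) h₀ hV hd
    (fun ρ hρ => ?_) fun x => ?_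
  · simpa [circleMap, mul_assoc] using
      hasWindingNumber_mul_exp (mul_ne_zero hA (ofReal_ne_zero.2 hρ.ne')) 1
  · simp only [wirtingerMap_apply, zero_mul, add_zero, add_sub_cancel_left, norm_mul, norm_conj]
    linarith

theorem hasPoincareIndex_neg_one (h₀ : V z₀ = 0) (hV : ∀ᶠ z in 𝓝[≠] z₀, ContinuousAt V z)
    (hd : HasFDerivAt V (wirtingerMap A B) z₀) (hAB : ‖A‖ < ‖B‖) :
    HasPoincareIndex V z₀ (-1) := by
  have hB : B ≠ 0 := norm_pos_iff.1 ((norm_nonneg A).trans_lt hAB)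
  refine hasPoincareIndex_of_norm_fderiv_sub_le (M := wirtingerMap 0 B) (sub_pos.2 hAB) h₀ hV hd
    (fun ρ hρ => ?_) fun x => ?_
  · simpa [circleMap, mul_assoc, ← exp_conj] using
      hasWindingNumber_mul_exp (mul_ne_zero hB (ofReal_ne_zero.2 hρ.ne')) (-1)
  · simp only [wirtingerMap_apply, zero_mul, zero_add, add_sub_cancel_right, norm_mul, norm_conj]
    linarith

theorem exists_ne_zero_mul_add_mul_conj_eq_zero (h : ‖A‖ = ‖B‖) :
    ∃ x : ℂ, x ≠ 0 ∧ A * x + B * conj x = 0 := by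
  obtain rfl | hA := eq_or_ne A 0
  · have hB : B = 0 := by rw [← norm_eq_zero, ← h, norm_zero]
    exact ⟨1, one_ne_zero, by simp [hB]⟩
  obtain ⟨x, hx⟩ := IsAlgClosed.exists_pow_nat_eq (-B / A) two_pos
  have norm_x : ‖x‖ = 1 := by
    rw [← pow_eq_one_iff_of_nonneg (norm_nonneg x) two_ne_zero, ← norm_pow, hx, norm_div, norm_neg,
      ← h, div_self (norm_ne_zero_iff.2 hA)]
  have hx₀ : x ≠ 0 := norm_ne_zero_iff.1 (norm_x.trans_ne one_ne_zero)
  refine ⟨x, hx₀, mul_right_cancel₀ hx₀ ?_⟩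
  have conj_mul_x : conj x * x = 1 := by rw [conj_mul', norm_x, ofReal_one, one_pow]
  rw [eq_div_iff hA] at hx
  linear_combination hx + B * conj_mul_x

theorem isJacobianEigenvalue_iff (hd : HasFDerivAt V (wirtingerMap A B) z₀) {μ : ℝ} :
    IsJacobianEigenvalue V z₀ μ ↔ μ ^ 2 - 2 * A.re * μ + (‖A‖ ^ 2 - ‖B‖ ^ 2) = 0 := by
  have norm_sub_eq_iff : ‖A - μ‖ = ‖B‖ ↔ μ ^ 2 - 2 * A.re * μ + (‖A‖ ^ 2 - ‖B‖ ^ 2) = 0 := by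
    rw [← sq_eq_sq₀ (norm_nonneg _) (norm_nonneg _)]
    simp only [← normSq_eq_norm_sq, normSq_apply, sub_re, sub_im, ofReal_re, ofReal_im]
    constructor <;> intro h <;> linarith
  rw [← norm_sub_eq_iff, IsJacobianEigenvalue, hd.fderiv]
  constructor
  · intro h
    obtain ⟨x, hx⟩ := h.exists_hasEigenvector
    have hx_eq : (A - μ) * x = -(B * conj x) := by
      have := hx.apply_eq_smul
      simp only [ContinuousLinearMap.coe_coe, wirtingerMap_apply, real_smul] at this
      linear_combination this
    have hnorm := congrArg norm hx_eq
    rw [norm_neg, norm_mul, norm_mul, norm_conj] at hnorm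
    exact mul_right_cancel₀ (norm_ne_zero_iff.2 hx.2) hnorm
  · intro h
    obtain ⟨x, hx₀, hx⟩ := exists_ne_zero_mul_add_mul_conj_eq_zero h
    refine Module.End.hasEigenvalue_of_hasEigenvector (x := x)
      ⟨Module.End.mem_eigenspace_iff.2 ?_, hx₀⟩
    simp only [ContinuousLinearMap.coe_coe, wirtingerMap_apply, real_smul]
    linear_combination hx

theorem isSaddle_iff (h₀ : V z₀ = 0) (hd : HasFDerivAt V (wirtingerMap A B) z₀) :
    IsSaddle V z₀ ↔ ‖A‖ < ‖B‖ := by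
  simp only [IsSaddle, isJacobianEigenvalue_iff hd, h₀, hd.differentiableAt, true_and]
  constructor
  · rintro ⟨a, b, ha, hb, ha_eig, hb_eig⟩
    have trace_eq : a + b - 2 * A.re = 0 := by
      refine mul_left_cancel₀ (sub_ne_zero.2 (ha.trans hb).ne) ?_
      linear_combination ha_eig - hb_eig
    have det_eq : ‖A‖ ^ 2 - ‖B‖ ^ 2 = a * b := by linear_combination ha_eig - a * trace_eq
    exact lt_of_pow_lt_pow_left₀ 2 (norm_nonneg _) (by nlinarith)
  · intro h
    have det_neg : ‖A‖ ^ 2 - ‖B‖ ^ 2 < 0 := by nlinarith [norm_nonneg A]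
    set d := ‖A‖ ^ 2 - ‖B‖ ^ 2
    have sq_sqrt := Real.sq_sqrt (by nlinarith [sq_nonneg A.re] : 0 ≤ A.re ^ 2 - d)
    obtain ⟨hleft, hright⟩ := abs_lt.1 (Real.lt_sqrt_of_sq_lt (by rw [sq_abs]; linarith) :
      |A.re| < √(A.re ^ 2 - d))
    exact ⟨A.re - √(A.re ^ 2 - d), A.re + √(A.re ^ 2 - d), by linarith, by linarith,
      by linear_combination sq_sqrt, by linear_combination sq_sqrt⟩

end LinearPart

section WirtingerCalculus

variable {f g : ℂ → ℂ} {z A B C D : ℂ}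

theorem hasFDerivAt_wirtingerMap_id : HasFDerivAt (fun z : ℂ => z) (wirtingerMap 1 0) z :=
  (hasFDerivAt_id z).congr_fderiv (by ext x; simp)

theorem hasFDerivAt_wirtingerMap_mul (hf : HasFDerivAt f (wirtingerMap A B) z)
    (hg : HasFDerivAt g (wirtingerMap C D) z) :
    HasFDerivAt (fun z => f z * g z)
      (wirtingerMap (f z * C + g z * A) (f z * D + g z * B)) z :=
  (hf.mul hg).congr_fderiv <| by
    ext x
    simp only [add_apply, smul_apply, wirtingerMap_apply, smul_eq_mul]
    ring

theorem hasFDerivAt_wirtingerMap_const_add_mul (hf : HasFDerivAt f (wirtingerMap A B) z) (a b : ℂ) :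
    HasFDerivAt (fun z => a + b * f z) (wirtingerMap (b * A) (b * B)) z :=
  ((hf.const_mul b).const_add a).congr_fderiv <| by
    ext x
    simp only [smul_apply, wirtingerMap_apply, smul_eq_mul]
    ring

theorem hasFDerivAt_wirtingerMap_norm_sq :
    HasFDerivAt (fun z : ℂ => (‖z‖ : ℂ) ^ 2) (wirtingerMap (conj z) z) z := by
  simp_rw [← mul_conj']
  refine ((hasFDerivAt_id z).mul conjCLE.hasFDerivAt).congr_fderiv ?_
  ext x
  simp only [id_eq, ContinuousAlgEquiv.coeCLE_apply, conjCAE_apply, add_apply, smul_apply,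
    ContinuousLinearEquiv.coe_coe, smul_eq_mul, ContinuousLinearMap.id_apply, wirtingerMap_apply]
  ring

theorem hasDerivAt_comp_line {L : ℂ →L[ℝ] ℂ} {t : ℝ} {v : ℂ} (hf : HasFDerivAt f L (z + t * v)) :
    HasDerivAt (fun t : ℝ => f (z + t * v)) (L v) t := by
  have line : HasDerivAt (fun t : ℝ => z + t * v) v t := by
    simpa using ((hasDerivAt_id t).ofReal_comp.mul_const v).const_add z
  exact hf.comp_hasDerivAt t line

theorem iteratedDeriv_two_comp_line {f₁ f₂ : ℂ → ℂ} {L₁ L₂ : ℂ →L[ℝ] ℂ}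
    (hf : ∀ᶠ w in 𝓝 z, HasFDerivAt f (wirtingerMap (f₁ w) (f₂ w)) w)
    (h₁ : HasFDerivAt f₁ L₁ z) (h₂ : HasFDerivAt f₂ L₂ z) (v : ℂ) (w : ℂ →L[ℝ] ℝ) :
    iteratedDeriv 2 (fun t : ℝ => w (f (z + t * v))) 0 = w (L₁ v * v + L₂ v * conj v) := by
  have line_zero : z + ((0 : ℝ) : ℂ) * v = z := by simp
  have first : deriv (fun t : ℝ => w (f (z + t * v))) =ᶠ[𝓝 0]
      fun t : ℝ => w (f₁ (z + t * v) * v + f₂ (z + t * v) * conj v) := by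
    have line_tendsto : Tendsto (fun t : ℝ => z + t * v) (𝓝 0) (𝓝 z) :=
      Continuous.tendsto' (by fun_prop) _ _ line_zero
    filter_upwards [line_tendsto.eventually hf] with t ht
    exact (w.hasFDerivAt.comp_hasDerivAt t (hasDerivAt_comp_line ht)).deriv
  rw [iteratedDeriv_succ, iteratedDeriv_one, first.deriv_eq]
  rw [← line_zero] at h₁ h₂
  exact (w.hasFDerivAt.comp_hasDerivAt 0 (((hasDerivAt_comp_line h₁).mul_const v).add
    ((hasDerivAt_comp_line h₂).mul_const (conj v)))).deriv

end WirtingerCalculus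

section EquivariantField

/-- The unit complex number `e^{-2miθ}`, for `θ` the argument of `z`. -/
noncomputable def phase (m : ℕ) (z : ℂ) : ℂ := (conj z / z) ^ m

/-- The `2m`-fold rotationally symmetric vector field `z ↦ p z + |z|² z (s - e^{-2mi arg z})`. The
polar system is the case `m = 6`, with `p = p₁ + i p₂` and `s = s₁ + i s₂`. -/
noncomputable def equivariantField (m : ℕ) (p s z : ℂ) : ℂ :=
  z * (p + (‖z‖ : ℂ) ^ 2 * (s - phase m z))

variable {m : ℕ} {p s z : ℂ}

theorem norm_phase (m : ℕ) (hz : z ≠ 0) : ‖phase m z‖ = 1 := by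
  rw [phase, norm_pow, norm_div, norm_conj, div_self (norm_ne_zero_iff.2 hz), one_pow]

theorem phase_mul_conj_phase (m : ℕ) (hz : z ≠ 0) : phase m z * conj (phase m z) = 1 := by
  rw [mul_conj', norm_phase m hz, ofReal_one, one_pow]

theorem phase_ne_zero (m : ℕ) (hz : z ≠ 0) : phase m z ≠ 0 :=
  norm_ne_zero_iff.1 ((norm_phase m hz).trans_ne one_ne_zero)

theorem phase_eq_exp (m : ℕ) (hz : z ≠ 0) : phase m z = exp ((-(2 * m * z.arg) : ℝ) * I) := by
  have conj_eq : conj z = ‖z‖ * exp (-(z.arg * I)) := by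
    calc conj z = conj (‖z‖ * exp (z.arg * I)) := by rw [norm_mul_exp_arg_mul_I]
      _ = ‖z‖ * exp (-(z.arg * I)) := by
        rw [map_mul, conj_ofReal, ← exp_conj, map_mul, conj_ofReal, conj_I, mul_neg]
  have quot_eq : conj z / z = exp (-(2 * z.arg * I)) := by
    calc conj z / z = ‖z‖ * exp (-(z.arg * I)) / (‖z‖ * exp (z.arg * I)) := by
          rw [norm_mul_exp_arg_mul_I, conj_eq]
      _ = exp (-(2 * z.arg * I)) := by
        rw [mul_div_mul_left _ _ (ofReal_ne_zero.2 (norm_ne_zero_iff.2 hz)), ← exp_sub]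
        ring_nf
  rw [phase, quot_eq, ← exp_nat_mul]
  push_cast
  ring_nf

theorem planarField_eq_equivariantField (p₁ p₂ s₁ s₂ : ℝ) :
    planarField p₁ p₂ s₁ s₂ = equivariantField 6 ⟨p₁, p₂⟩ ⟨s₁, s₂⟩ := by
  funext z
  obtain rfl | hz := eq_or_ne z 0
  · simp [planarField, equivariantField]
  have hr : ‖z‖ ≠ 0 := norm_ne_zero_iff.2 hz
  have radial : polarR p₁ s₁ (‖z‖ ^ 2) z.arg / (2 * ‖z‖ ^ 2) =
      p₁ + ‖z‖ ^ 2 * (s₁ - Real.cos (12 * z.arg)) := by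
    rw [polarR]
    field_simp
  have phase_eq : phase 6 z = ⟨Real.cos (12 * z.arg), -Real.sin (12 * z.arg)⟩ := by
    have angle : -(2 * (6 : ℕ) * z.arg) = -(12 * z.arg) := by push_cast; ring
    rw [phase_eq_exp 6 hz, angle, exp_mul_I, ← ofReal_cos, ← ofReal_sin, Real.cos_neg,
      Real.sin_neg]
    apply Complex.ext <;> simp only [add_re, add_im, re_ofReal_mul, im_ofReal_mul, ofReal_re,
      ofReal_im, I_re, I_im, mul_zero, mul_one, add_zero, zero_add]
  rw [planarField, equivariantField, phase_eq, radial, polarTheta, mul_comm, ← ofReal_pow]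
  congr 1
  apply Complex.ext <;> simp only [add_re, add_im, sub_re, sub_im, re_ofReal_mul, im_ofReal_mul,
    ofReal_re, ofReal_im, I_re, I_im] <;> ring

theorem equivariantField_eq_zero_iff (hz : z ≠ 0) :
    equivariantField m p s z = 0 ↔ p + (‖z‖ : ℂ) ^ 2 * (s - phase m z) = 0 := by
  rw [equivariantField, mul_eq_zero, or_iff_right hz]

theorem contDiffAt_equivariantField (hz : z ≠ 0) {n : WithTop ℕ∞} :
    ContDiffAt ℝ n (equivariantField m p s) z := by
  have hid : ContDiffAt ℝ n (fun z : ℂ => z) z := contDiffAt_id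
  have hconj : ContDiffAt ℝ n (fun z : ℂ => conj z) z := conjCLE.contDiff.contDiffAt
  have hphase : ContDiffAt ℝ n (phase m) z := (hconj.mul (hid.inv hz)).pow m
  have hnorm : ContDiffAt ℝ n (fun z : ℂ => (‖z‖ : ℂ) ^ 2) z := by
    simpa only [← mul_conj'] using hid.mul hconj
  exact hid.mul (contDiffAt_const.add (hnorm.mul (contDiffAt_const.sub hphase)))

theorem eventually_continuousAt_equivariantField (hz : z ≠ 0) :
    ∀ᶠ w in 𝓝 z, ContinuousAt (equivariantField m p s) w :=
  (eventually_ne_nhds hz).mono fun _ hw => (contDiffAt_equivariantField hw (n := 0)).continuousAt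

theorem hasFDerivAt_phase (m : ℕ) (hz : z ≠ 0) :
    HasFDerivAt (phase m)
      (wirtingerMap (-(m * phase m z / z)) (m * phase m z / conj z)) z := by
  have hz' : conj z ≠ 0 := (map_ne_zero _).2 hz
  have quot : HasFDerivAt (fun z : ℂ => conj z / z) (wirtingerMap (-(conj z / z ^ 2)) z⁻¹) z := by
    refine ((conjCLE.hasFDerivAt (x := z)).mul (hasFDerivAt_inv' (𝕜 := ℝ) hz)).congr_fderiv ?_
    ext x
    simp only [ContinuousAlgEquiv.coeCLE_apply, conjCAE_apply, smul_neg, add_apply, neg_apply,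
      smul_apply, ContinuousLinearMap.mulLeftRight_apply, smul_eq_mul,
      ContinuousLinearEquiv.coe_coe, wirtingerMap_apply]
    field_simp
  refine (quot.pow m).congr_fderiv ?_
  ext x
  obtain _ | m := m
  · simp
  · simp only [phase, add_tsub_cancel_right, nsmul_eq_mul, pow_succ, smul_apply,
      wirtingerMap_apply, smul_eq_mul]
    field_simp

theorem hasFDerivAt_equivariantField (hz : z ≠ 0) :
    HasFDerivAt (equivariantField m p s)
      (wirtingerMap (p + (‖z‖ : ℂ) ^ 2 * (2 * s + (m - 2) * phase m z))
        (z ^ 2 * (s - (m + 1) * phase m z))) z := by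
  have hz' : conj z ≠ 0 := (map_ne_zero _).2 hz
  have h := hasFDerivAt_wirtingerMap_mul hasFDerivAt_wirtingerMap_id
    (hasFDerivAt_wirtingerMap_const_add_mul (hasFDerivAt_wirtingerMap_mul
      hasFDerivAt_wirtingerMap_norm_sq
      (hasFDerivAt_wirtingerMap_const_add_mul (hasFDerivAt_phase m hz) s (-1))) p 1)
  convert h using 2
  · rw [equivariantField]; ring
  · rw [← mul_conj']; field_simp; ring
  · rw [← mul_conj']; field_simp; ring

end EquivariantField

section CriticalPoint

variable {m : ℕ} {p s z : ℂ}

theorem hasFDerivAt_equivariantField_of_eq_zero (hz : z ≠ 0) (hV : equivariantField m p s z = 0) :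
    HasFDerivAt (equivariantField m p s)
      (wirtingerMap ((‖z‖ : ℂ) ^ 2 * (s + (m - 1) * phase m z))
        (z ^ 2 * (s - (m + 1) * phase m z))) z := by
  convert hasFDerivAt_equivariantField hz using 2
  linear_combination -(equivariantField_eq_zero_iff hz).1 hV

theorem jacobian_det_eq (m : ℕ) (s : ℂ) (hz : z ≠ 0) :
    ‖(‖z‖ : ℂ) ^ 2 * (s + (m - 1) * phase m z)‖ ^ 2 - ‖z ^ 2 * (s - (m + 1) * phase m z)‖ ^ 2 =
      4 * m * ‖z‖ ^ 4 * ((s * conj (phase m z)).re - 1) := by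
  have norm_phase_sq : (phase m z).re * (phase m z).re + (phase m z).im * (phase m z).im = 1 := by
    rw [← normSq_apply, normSq_eq_norm_sq, norm_phase m hz, one_pow]
  rw [norm_mul, norm_mul, norm_pow, norm_pow, norm_real, norm_norm, mul_pow, mul_pow,
    ← normSq_eq_norm_sq (s + _), ← normSq_eq_norm_sq (s - _)]
  simp only [normSq_apply, add_re, add_im, sub_re, sub_im, mul_re, mul_im, natCast_re, natCast_im,
    one_re, one_im, conj_re, conj_im]
  linear_combination (-4 * m * ‖z‖ ^ 4) * norm_phase_sq

theorem isSaddle_equivariantField_iff (hm : m ≠ 0) (hz : z ≠ 0)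
    (hV : equivariantField m p s z = 0) :
    IsSaddle (equivariantField m p s) z ↔ (s * conj (phase m z)).re < 1 := by
  have factor_pos : 0 < 4 * (m : ℝ) * ‖z‖ ^ 4 := by positivity
  rw [isSaddle_iff hV (hasFDerivAt_equivariantField_of_eq_zero hz hV),
    ← sq_lt_sq₀ (norm_nonneg _) (norm_nonneg _), ← sub_neg, jacobian_det_eq m s hz,
    ← neg_pos, ← mul_neg, mul_pos_iff_of_pos_left factor_pos, neg_sub, sub_pos]

theorem hasPoincareIndex_equivariantField_one_iff (hm : m ≠ 0) (hz : z ≠ 0)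
    (hV : equivariantField m p s z = 0) (hne : (s * conj (phase m z)).re ≠ 1) :
    HasPoincareIndex (equivariantField m p s) z 1 ↔ 1 < (s * conj (phase m z)).re := by
  have hd := hasFDerivAt_equivariantField_of_eq_zero hz hV
  have hcont : ∀ᶠ w in 𝓝[≠] z, ContinuousAt (equivariantField m p s) w :=
    nhdsWithin_le_nhds (eventually_continuousAt_equivariantField hz)
  refine ⟨fun h => hne.lt_or_gt.resolve_left fun hlt => ?_, fun h => ?_⟩
  · have hneg := hasPoincareIndex_neg_one hV hcont hd
      ((isSaddle_iff hV hd).1 ((isSaddle_equivariantField_iff hm hz hV).2 hlt))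
    exact absurd (h.unique hneg) (by norm_num)
  · have factor_pos : 0 < 4 * (m : ℝ) * ‖z‖ ^ 4 := by positivity
    have det_pos := mul_pos factor_pos (sub_pos.2 h)
    rw [← jacobian_det_eq m s hz, sub_pos] at det_pos
    exact hasPoincareIndex_one hV hcont hd (lt_of_pow_lt_pow_left₀ 2 (norm_nonneg _) det_pos)

theorem isJacobianEigenvalue_equivariantField_zero (hz : z ≠ 0)
    (hV : equivariantField m p s z = 0) (h : (s * conj (phase m z)).re = 1) :
    IsJacobianEigenvalue (equivariantField m p s) z 0 := by
  rw [isJacobianEigenvalue_iff (hasFDerivAt_equivariantField_of_eq_zero hz hV),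
    jacobian_det_eq m s hz, h]
  ring

theorem re_conj_phase_mul_nonneg {w : ℂ} (hz : z ≠ 0) (hw : w ≠ 0)
    (hV : equivariantField m p s z = 0) (h : (s * conj (phase m z)).re = 1) :
    0 ≤ (conj (phase m z) * (p + (‖w‖ : ℂ) ^ 2 * (s - phase m w))).re := by
  have hle : (conj (phase m z) * phase m w).re ≤ 1 := (re_le_norm _).trans_eq <| by
    rw [norm_mul, norm_conj, norm_phase m hz, norm_phase m hw, one_mul]
  have hsplit : conj (phase m z) * (p + (‖w‖ : ℂ) ^ 2 * (s - phase m w)) =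
      ((‖z‖ ^ 2 : ℝ) : ℂ) * (1 - s * conj (phase m z)) +
        ((‖w‖ ^ 2 : ℝ) : ℂ) * (s * conj (phase m z) - conj (phase m z) * phase m w) := by
    push_cast
    linear_combination conj (phase m z) * (equivariantField_eq_zero_iff hz).1 hV +
      (‖z‖ : ℂ) ^ 2 * phase_mul_conj_phase m hz
  rw [hsplit, add_re, re_ofReal_mul, re_ofReal_mul, sub_re, sub_re, h, one_re, sub_self, mul_zero,
    zero_add]
  exact mul_nonneg (sq_nonneg _) (sub_nonneg.2 hle)

theorem hasPoincareIndex_equivariantField_zero (hz : z ≠ 0) (hV : equivariantField m p s z = 0)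
    (h : (s * conj (phase m z)).re = 1)
    (hiso : ∀ᶠ w in 𝓝[≠] z, equivariantField m p s w ≠ 0) :
    HasPoincareIndex (equivariantField m p s) z 0 := by
  have hu := phase_ne_zero m hz
  have factor_ne : ∀ w ≠ 0, w * phase m z ≠ 0 := fun w hw => mul_ne_zero hw hu
  have near : ∀ᶠ w in 𝓝[≠] z, w ≠ 0 := nhdsWithin_le_nhds (eventually_ne_nhds hz)
  have quot_index : HasPoincareIndex (fun w => equivariantField m p s w / (w * phase m z)) z 0 := by
    refine hasPoincareIndex_zero_of_mem_slitPlane (by rw [hV, zero_div]) ?_ ?_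
    · filter_upwards [near] with w hw
      exact (contDiffAt_equivariantField hw (n := 0)).continuousAt.div (by fun_prop)
        (factor_ne w hw)
    · filter_upwards [near, hiso] with w hw hne
      have quot_eq : equivariantField m p s w / (w * phase m z) =
          conj (phase m z) * (p + (‖w‖ : ℂ) ^ 2 * (s - phase m w)) := by
        rw [equivariantField, div_eq_iff (factor_ne w hw)]
        linear_combination
          -(w * (p + (‖w‖ : ℂ) ^ 2 * (s - phase m w))) * phase_mul_conj_phase m hz
      have quot_ne := div_ne_zero hne (factor_ne w hw)
      rw [quot_eq] at quot_ne ⊢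
      rw [mem_slitPlane_iff]
      by_contra! hcon
      exact quot_ne (Complex.ext (hcon.1.antisymm (re_conj_phase_mul_nonneg hz hw hV h)) hcon.2)
  refine (quot_index.mul_left (f := fun w => w * phase m z) (.of_forall fun w => by fun_prop)
    (factor_ne z hz)).congr ?_
  filter_upwards [eventually_ne_nhds hz] with w hw
  exact mul_div_cancel₀ _ (factor_ne w hw)

end CriticalPoint

section SaddleNode

variable {m : ℕ} {p s z : ℂ}

theorem iteratedDeriv_two_equivariantField (hz : z ≠ 0) (ν : ℂ) (w : ℂ →L[ℝ] ℝ) :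
    iteratedDeriv 2 (fun t : ℝ => w (equivariantField m p s (z + t * (z * ν)))) 0 =
      w ((‖z‖ : ℂ) ^ 2 * z * (s * (2 * ν ^ 2 + 4 * ν * conj ν) - phase m z *
        (m * (m + 1) * conj ν ^ 2 - (2 * m ^ 2 - 2 * m - 4) * ν * conj ν
          + (m - 1) * (m - 2) * ν ^ 2))) := by
  have hz' : conj z ≠ 0 := (map_ne_zero _).2 hz
  have hphase := hasFDerivAt_phase m hz
  have h₁ := hasFDerivAt_wirtingerMap_const_add_mul (hasFDerivAt_wirtingerMap_mul
    hasFDerivAt_wirtingerMap_norm_sq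
    (hasFDerivAt_wirtingerMap_const_add_mul hphase (2 * s) (m - 2))) p 1
  have h₂ := hasFDerivAt_wirtingerMap_mul (hasFDerivAt_wirtingerMap_mul
    hasFDerivAt_wirtingerMap_id hasFDerivAt_wirtingerMap_id)
    (hasFDerivAt_wirtingerMap_const_add_mul hphase s (-(m + 1)))
  have hV : ∀ᶠ w in 𝓝 z, HasFDerivAt (equivariantField m p s) (wirtingerMap
      (p + 1 * ((‖w‖ : ℂ) ^ 2 * (2 * s + (m - 2) * phase m w)))
      (w * w * (s + -(m + 1) * phase m w))) w := by
    filter_upwards [eventually_ne_nhds hz] with w hw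
    convert hasFDerivAt_equivariantField hw using 2 <;> ring
  rw [iteratedDeriv_two_comp_line hV h₁ h₂]
  congr 1
  simp only [wirtingerMap_apply, map_mul, ← mul_conj']
  field_simp
  ring

theorem eq_phase_mul_of_re_eq_one (hz : z ≠ 0) (h : (s * conj (phase m z)).re = 1) :
    s = phase m z * (1 + (s * conj (phase m z)).im * I) := by
  have hsu : s * conj (phase m z) = 1 + (s * conj (phase m z)).im * I := by
    conv_lhs => rw [← re_add_im (s * conj (phase m z)), h, ofReal_one]
  rw [← hsu]
  linear_combination -s * phase_mul_conj_phase m hz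

/- The right-hand side is purely imaginary and vanishes at `ξ = m - k i`. So `⟪z u, ·⟫`, where `u`
is the phase of `z`, is a left null vector of the Jacobian, and `z (m - k i)` is a right one. -/
theorem fderiv_equivariantField_mul_conj {k : ℝ} (hz : z ≠ 0)
    (hV : equivariantField m p s z = 0) (hs : s = phase m z * (1 + k * I)) (ξ : ℂ) :
    fderiv ℝ (equivariantField m p s) z (z * ξ) * conj (z * phase m z) =
      (‖z‖ : ℂ) ^ 4 * ((m + k * I) * ξ - conj ((m + k * I) * ξ)) := by
  rw [(hasFDerivAt_equivariantField_of_eq_zero hz hV).fderiv, wirtingerMap_apply]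
  set u := phase m z
  have huu : u * conj u = 1 := phase_mul_conj_phase m hz
  have hzz : conj z * z = (‖z‖ : ℂ) ^ 2 := conj_mul' z
  have hnorm : (‖z‖ : ℂ) ^ 4 = (conj z * z) ^ 2 := by rw [hzz]; ring
  rw [hs, hnorm, ← hzz]
  simp only [map_mul, map_add, conj_natCast, conj_ofReal, conj_I]
  linear_combination (conj z * z) ^ 2 * ((m + k * I) * ξ - (m - k * I) * conj ξ) * huu

theorem iteratedDeriv_two_inner_equivariantField {k : ℝ} (hz : z ≠ 0)
    (hs : s = phase m z * (1 + k * I)) :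
    iteratedDeriv 2 (fun t : ℝ => innerSL ℝ (z * phase m z)
        (equivariantField m p s (z + t * (z * (m - k * I))))) 0 = 4 * m ^ 2 * k ^ 2 * ‖z‖ ^ 4 := by
  rw [iteratedDeriv_two_equivariantField hz, innerSL_apply_apply, Complex.inner]
  set c : ℂ := ((4 * m ^ 2 * k ^ 2 : ℝ) : ℂ) + ((2 * k * (k ^ 2 - m ^ 2) : ℝ) : ℂ) * I with hc
  have bracket_eq : (1 + k * I) * (2 * (m - k * I) ^ 2 + 4 * (m - k * I) * (m + k * I)) -
      (m * (m + 1) * (m + k * I) ^ 2 - (2 * m ^ 2 - 2 * m - 4) * (m - k * I) * (m + k * I) +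
        (m - 1) * (m - 2) * (m - k * I) ^ 2) = c := by
    rw [hc]
    push_cast
    ring_nf
    simp only [I_sq, I_pow_three]
    ring
  have conj_eq : conj (m - k * I : ℂ) = m + k * I := by
    rw [map_sub, map_mul, conj_natCast, conj_ofReal, conj_I, mul_neg, sub_neg_eq_add]
  have norm_pow_four : ((‖z‖ ^ 4 : ℝ) : ℂ) = (z * conj z) ^ 2 := by
    rw [mul_conj', ← pow_mul, ofReal_pow]
  trans (((‖z‖ ^ 4 : ℝ) : ℂ) * c).re
  · rw [conj_eq, map_mul, hs, norm_pow_four, ← mul_conj']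
    congr 1
    linear_combination (z * conj z) ^ 2 * c * phase_mul_conj_phase m hz +
      (z * conj z) ^ 2 * phase m z * conj (phase m z) * bracket_eq
  · rw [re_ofReal_mul, hc, add_re, ofReal_re, re_ofReal_mul, I_re]
    ring

theorem isSaddleNode_equivariantField (hm : m ≠ 0) (hz : z ≠ 0)
    (hV : equivariantField m p s z = 0) (h : (s * conj (phase m z)).re = 1) (hs : 1 < ‖s‖)
    (hμ : ∃ μ : ℝ, μ ≠ 0 ∧ IsJacobianEigenvalue (equivariantField m p s) z μ) :
    IsSaddleNode (equivariantField m p s) z := by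
  set k := (s * conj (phase m z)).im
  have hsu : s = phase m z * (1 + k * I) := eq_phase_mul_of_re_eq_one hz h
  have hk : k ≠ 0 := fun hk => by
    rw [hsu, hk, ofReal_zero, zero_mul, add_zero, mul_one, norm_phase m hz] at hs
    exact lt_irrefl _ hs
  have hzu : z * phase m z ≠ 0 := mul_ne_zero hz (phase_ne_zero m hz)
  have hν : (m - k * I : ℂ) ≠ 0 := fun h₀ => hk (by simpa using congrArg im h₀)
  have hfderiv := fderiv_equivariantField_mul_conj hz hV hsu
  refine ⟨hV, contDiffAt_equivariantField hz, hμ, z * (m - k * I), innerSL ℝ (z * phase m z),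
    mul_ne_zero hz hν, fun h₀ => hzu ?_, ?_, fun x => ?_, ?_⟩
  · exact inner_self_eq_zero.1 (DFunLike.congr_fun h₀ (z * phase m z))
  · refine mul_right_cancel₀ ((map_ne_zero conj).2 hzu) ?_
    rw [hfderiv, map_mul]
    simp only [map_add, map_sub, map_mul, conj_natCast, conj_ofReal, conj_I]
    ring
  · obtain ⟨ξ, rfl⟩ : ∃ ξ, x = z * ξ := ⟨x / z, (mul_div_cancel₀ x hz).symm⟩
    rw [innerSL_apply_apply, Complex.inner, hfderiv, sub_conj, ← ofReal_pow, re_ofReal_mul]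
    simp
  · rw [iteratedDeriv_two_inner_equivariantField hz hsu]
    positivity

theorem isSaddleNode_equivariantField_iff (hm : m ≠ 0) (hz : z ≠ 0)
    (hV : equivariantField m p s z = 0) (h : (s * conj (phase m z)).re = 1) (hs : 1 < ‖s‖) :
    IsSaddleNode (equivariantField m p s) z ↔ s.re + (m - 1) * (phase m z).re ≠ 0 := by
  set A := (‖z‖ : ℂ) ^ 2 * (s + (m - 1) * phase m z) with hA
  have trace_eq : A.re = ‖z‖ ^ 2 * (s.re + (m - 1) * (phase m z).re) := by
    rw [hA, ← ofReal_pow, re_ofReal_mul, add_re, ← ofReal_natCast, ← ofReal_one, ← ofReal_sub,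
      re_ofReal_mul]
  have eigenvalue_iff : ∀ μ : ℝ, IsJacobianEigenvalue (equivariantField m p s) z μ ↔
      μ * (μ - 2 * A.re) = 0 := fun μ => by
    rw [isJacobianEigenvalue_iff (hasFDerivAt_equivariantField_of_eq_zero hz hV),
      jacobian_det_eq m s hz, h, ← hA]
    ring_nf
  refine Iff.trans ⟨fun hsn => ?_, fun htr => ?_⟩ (?_ : A.re ≠ 0 ↔ _)
  · obtain ⟨μ, hμ, h_eig⟩ := hsn.2.2.1
    rintro htr
    rw [eigenvalue_iff, htr] at h_eig
    simp [hμ] at h_eig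
  · refine isSaddleNode_equivariantField hm hz hV h hs ⟨2 * A.re, by simpa using htr, ?_⟩
    rw [eigenvalue_iff]
    ring
  · rw [trace_eq, mul_ne_zero_iff, and_iff_right (pow_ne_zero 2 (norm_ne_zero_iff.2 hz))]

end SaddleNode

section Roots

/-- The sector `α ≤ θ < α + 2π/n`, which is one `n`-th of the punctured plane. -/
def angularSector (n : ℕ) (α : ℝ) : Set ℂ :=
  {z | ∃ ρ θ : ℝ, 0 < ρ ∧ α ≤ θ ∧ θ < α + 2 * π / n ∧ z = (ρ : ℂ) * exp ((θ : ℂ) * I)}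

variable {n : ℕ} {c z : ℂ} {α ρ θ : ℝ}

theorem sector_eq_angularSector (α : ℝ) : sector α = angularSector 12 α := by
  rw [sector, angularSector, Nat.cast_ofNat]

theorem ne_zero_of_mem_angularSector (hz : z ∈ angularSector n α) : z ≠ 0 := by
  obtain ⟨ρ, θ, hρ, -, -, rfl⟩ := hz
  exact mul_ne_zero (ofReal_ne_zero.2 hρ.ne') (exp_ne_zero _)

theorem ofReal_mul_exp_eq_iff (hρ : 0 < ρ) :
    (ρ : ℂ) * exp ((θ : ℂ) * I) = c ↔ ρ = ‖c‖ ∧ ∃ k : ℤ, θ = c.arg + k * (2 * π) := by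
  have exp_eq_iff : exp (θ * I) = exp (c.arg * I) ↔ ∃ k : ℤ, θ = c.arg + k * (2 * π) := by
    refine exp_eq_exp_iff_exists_int.trans (exists_congr fun k => ?_)
    rw [← ofReal_inj, ← mul_left_inj' (a := (θ : ℂ)) I_ne_zero]
    push_cast
    rw [add_mul, mul_assoc (k : ℂ)]
  rw [← exp_eq_iff]
  constructor
  · intro h
    have hnorm : ρ = ‖c‖ := by
      rw [← h, norm_mul, norm_exp_ofReal_mul_I, mul_one, norm_real, Real.norm_of_nonneg hρ.le]
    refine ⟨hnorm, mul_left_cancel₀ (ofReal_ne_zero.2 hρ.ne') (h.trans ?_)⟩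
    rw [hnorm, norm_mul_exp_arg_mul_I]
  · rintro ⟨rfl, h⟩
    rw [h, norm_mul_exp_arg_mul_I]

theorem ofReal_mul_exp_pow_eq_iff (hn : n ≠ 0) (hρ : 0 < ρ) :
    ((ρ : ℂ) * exp ((θ : ℂ) * I)) ^ n = c ↔
      ρ ^ n = ‖c‖ ∧ ∃ k : ℤ, θ = c.arg / n + k • (2 * π / n) := by
  have hn' : (n : ℝ) ≠ 0 := Nat.cast_ne_zero.2 hn
  have pow_eq : ((ρ : ℂ) * exp ((θ : ℂ) * I)) ^ n =
      ((ρ ^ n : ℝ) : ℂ) * exp (((n * θ : ℝ) : ℂ) * I) := by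
    rw [mul_pow, ← exp_nat_mul]
    push_cast
    rw [mul_assoc]
  rw [pow_eq, ofReal_mul_exp_eq_iff (pow_pos hρ n)]
  refine and_congr_right fun _ => exists_congr fun k => ?_
  rw [zsmul_eq_mul, mul_div_assoc', ← add_div, eq_div_iff hn', mul_comm]

theorem existsUnique_pow_eq_mem_angularSector (hn : n ≠ 0) (hc : c ≠ 0) (α : ℝ) :
    ∃! z : ℂ, z ^ n = c ∧ z ∈ angularSector n α := by
  have width_pos : 0 < 2 * π / n := by positivity
  obtain ⟨k, hk, hk_unique⟩ := existsUnique_add_zsmul_mem_Ico width_pos (c.arg / n) α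
  have root_pos : 0 < ‖c‖ ^ (n : ℝ)⁻¹ := Real.rpow_pos_of_pos (norm_pos_iff.2 hc) _
  have root_pow : (‖c‖ ^ (n : ℝ)⁻¹) ^ n = ‖c‖ := Real.rpow_inv_natCast_pow (norm_nonneg c) hn
  refine ⟨_, ⟨(ofReal_mul_exp_pow_eq_iff hn root_pos).2 ⟨root_pow, k, rfl⟩,
    _, _, root_pos, hk.1, hk.2, rfl⟩, ?_⟩
  rintro z ⟨hz, ρ, θ, hρ, hαθ, hθα, rfl⟩
  obtain ⟨hρn, l, rfl⟩ := (ofReal_mul_exp_pow_eq_iff hn hρ).1 hz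
  obtain rfl : l = k := hk_unique l ⟨hαθ, hθα⟩
  rw [(pow_left_inj₀ hρ.le root_pos.le hn).1 (hρn.trans root_pow.symm)]

theorem setOf_pow_eq_eq_nthRoots [DecidableEq ℂ] (hn : n ≠ 0) (c : ℂ) :
    {z : ℂ | z ^ n = c} = (Polynomial.nthRoots n c).toFinset := by
  ext z
  rw [Set.mem_ofPred_eq, Finset.mem_coe, Multiset.mem_toFinset,
    Polynomial.mem_nthRoots (Nat.pos_of_ne_zero hn)]

theorem finite_setOf_pow_eq (hn : n ≠ 0) (c : ℂ) : {z : ℂ | z ^ n = c}.Finite := by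
  classical
  rw [setOf_pow_eq_eq_nthRoots hn]
  exact Finset.finite_toSet _

theorem ncard_setOf_pow_eq (hn : n ≠ 0) (hc : c ≠ 0) : {z : ℂ | z ^ n = c}.ncard = n := by
  classical
  have hζ := isPrimitiveRoot_exp n hn
  rw [setOf_pow_eq_eq_nthRoots hn, Set.ncard_coe_finset,
    Multiset.toFinset_card_of_nodup (hζ.nthRoots_nodup hc), hζ.card_nthRoots,
    if_pos (IsAlgClosed.exists_pow_nat_eq c (Nat.pos_of_ne_zero hn))]

end Roots

section CriticalRing

/-- The zeros of `equivariantField m p s`. -/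
def equivariantZeros (m : ℕ) (p s : ℂ) : Set ℂ :=
  {z | equivariantField m p s z = 0}

/-- The values of `1 / |z|²` at the nonzero zeros `z` of `equivariantField m p s`: the positive
times at which the ray from `s` in direction `p` meets the unit circle. -/
def criticalParams (p s : ℂ) : Set ℝ :=
  {t | 0 < t ∧ ‖s + t * p‖ = 1}

/-- The zeros `z` of `equivariantField m p s` with `1 / |z|² = t`, for `t ∈ criticalParams p s`. -/
def criticalRing (m : ℕ) (p s : ℂ) (t : ℝ) : Set ℂ :=
  {z | ‖z‖ ^ 2 = t⁻¹ ∧ phase m z = s + t * p}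

variable {m : ℕ} {p s z : ℂ} {t t' : ℝ}

theorem criticalPoints_eq_equivariantZeros (p₁ p₂ s₁ s₂ : ℝ) :
    criticalPoints p₁ p₂ s₁ s₂ = equivariantZeros 6 ⟨p₁, p₂⟩ ⟨s₁, s₂⟩ := by
  rw [criticalPoints, equivariantZeros, planarField_eq_equivariantField]

theorem zero_mem_equivariantZeros : 0 ∈ equivariantZeros m p s :=
  zero_mul _

theorem zero_notMem_criticalRing (ht : 0 < t) : (0 : ℂ) ∉ criticalRing m p s t := fun h => by
  have hinv := h.1
  rw [norm_zero, zero_pow two_ne_zero] at hinv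
  exact (inv_pos.2 ht).ne hinv

theorem ne_zero_of_mem_criticalRing (ht : 0 < t) (hz : z ∈ criticalRing m p s t) : z ≠ 0 :=
  ne_of_mem_of_not_mem hz (zero_notMem_criticalRing ht)

theorem disjoint_criticalRing (h : t ≠ t') :
    Disjoint (criticalRing m p s t) (criticalRing m p s t') :=
  Set.disjoint_left.2 fun _ hz hz' => h (inv_injective (hz.1.symm.trans hz'.1))

theorem equivariantField_eq_zero_iff_phase_eq (hz : z ≠ 0) (ht : 0 < t) (hzt : ‖z‖ ^ 2 = t⁻¹) :
    equivariantField m p s z = 0 ↔ phase m z = s + t * p := by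
  have ht' : (t : ℂ) ≠ 0 := ofReal_ne_zero.2 ht.ne'
  rw [equivariantField_eq_zero_iff hz, ← ofReal_pow, hzt, ofReal_inv,
    ← mul_right_inj' ht', mul_add, mul_inv_cancel_left₀ ht', mul_zero]
  constructor <;> intro h
  · linear_combination -h
  · linear_combination -h

theorem equivariantField_eq_zero_of_mem_criticalRing (ht : 0 < t)
    (hz : z ∈ criticalRing m p s t) : equivariantField m p s z = 0 :=
  (equivariantField_eq_zero_iff_phase_eq (ne_zero_of_mem_criticalRing ht hz) ht hz.1).2 hz.2

theorem equivariantZeros_eq_insert_iUnion (m : ℕ) (p s : ℂ) :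
    equivariantZeros m p s = insert 0 (⋃ t ∈ criticalParams p s, criticalRing m p s t) := by
  ext z
  simp only [Set.mem_insert_iff, Set.mem_iUnion₂]
  constructor
  · intro hV
    refine or_iff_not_imp_left.2 fun hz => ?_
    have ht : 0 < (‖z‖ ^ 2)⁻¹ := inv_pos.2 (pow_pos (norm_pos_iff.2 hz) 2)
    have hphase := (equivariantField_eq_zero_iff_phase_eq hz ht (inv_inv _).symm).1 hV
    exact ⟨_, ⟨ht, hphase ▸ norm_phase m hz⟩, (inv_inv _).symm, hphase⟩
  · rintro (rfl | ⟨t, ⟨ht, -⟩, hz⟩)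
    · exact zero_mem_equivariantZeros
    · exact equivariantField_eq_zero_of_mem_criticalRing ht hz

theorem pow_two_mul_mul_phase (m : ℕ) (hz : z ≠ 0) :
    z ^ (2 * m) * phase m z = ((‖z‖ ^ 2 : ℝ) : ℂ) ^ m := by
  rw [phase, pow_mul, ← mul_pow, ofReal_pow, ← mul_conj', sq, mul_assoc, mul_div_cancel₀ _ hz]

theorem norm_sq_eq_and_phase_eq_iff {c : ℂ} {r : ℝ} (hm : m ≠ 0) (hr : 0 < r) (hc : ‖c‖ = 1) :
    ‖z‖ ^ 2 = r ∧ phase m z = c ↔ z ^ (2 * m) = (r : ℂ) ^ m * conj c := by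
  have c_mul_conj : c * conj c = 1 := by rw [mul_conj', hc, ofReal_one, one_pow]
  have ne_zero_of : ‖z‖ ^ 2 = r → z ≠ 0 := by
    rintro h rfl
    rw [norm_zero, zero_pow two_ne_zero] at h
    exact hr.ne h
  constructor
  · rintro ⟨hzr, rfl⟩
    rw [← hzr, ← pow_two_mul_mul_phase m (ne_zero_of hzr), mul_assoc, c_mul_conj, mul_one]
  · intro h
    have hzr : ‖z‖ ^ 2 = r := by
      refine (pow_left_inj₀ (by positivity) hr.le hm).1 ?_
      rw [← pow_mul, ← norm_pow, h, norm_mul, norm_conj, hc, mul_one, norm_pow, norm_real,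
        Real.norm_of_nonneg hr.le]
    have hphase := pow_two_mul_mul_phase m (ne_zero_of hzr)
    rw [h, hzr, mul_assoc] at hphase
    have conj_mul_phase : conj c * phase m z = 1 :=
      mul_left_cancel₀ (pow_ne_zero m (ofReal_ne_zero.2 hr.ne')) (hphase.trans (mul_one _).symm)
    exact ⟨hzr, by linear_combination c * conj_mul_phase - phase m z * c_mul_conj⟩

theorem exists_criticalRing_eq_setOf_pow_eq (hm : m ≠ 0) (ht : t ∈ criticalParams p s) :
    ∃ c ≠ 0, criticalRing m p s t = {z | z ^ (2 * m) = c} := by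
  obtain ⟨ht₀, hnorm⟩ := ht
  have ht_inv := inv_pos.2 ht₀
  refine ⟨((t⁻¹ : ℝ) : ℂ) ^ m * conj (s + t * p), ?_,
    Set.ext fun z => norm_sq_eq_and_phase_eq_iff hm ht_inv hnorm⟩
  refine mul_ne_zero (pow_ne_zero m (ofReal_ne_zero.2 ht_inv.ne')) ((map_ne_zero conj).2 ?_)
  exact norm_ne_zero_iff.1 (hnorm.trans_ne one_ne_zero)

theorem finite_criticalRing (hm : m ≠ 0) (ht : t ∈ criticalParams p s) :
    (criticalRing m p s t).Finite := by
  obtain ⟨c, -, hring⟩ := exists_criticalRing_eq_setOf_pow_eq hm ht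
  exact hring ▸ finite_setOf_pow_eq (mul_ne_zero two_ne_zero hm) c

theorem ncard_criticalRing (hm : m ≠ 0) (ht : t ∈ criticalParams p s) :
    (criticalRing m p s t).ncard = 2 * m := by
  obtain ⟨c, hc, hring⟩ := exists_criticalRing_eq_setOf_pow_eq hm ht
  exact hring ▸ ncard_setOf_pow_eq (mul_ne_zero two_ne_zero hm) hc

theorem existsUnique_mem_criticalRing_mem_angularSector (hm : m ≠ 0) (ht : t ∈ criticalParams p s)
    (α : ℝ) : ∃! z, z ∈ criticalRing m p s t ∧ z ∈ angularSector (2 * m) α := by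
  obtain ⟨c, hc, hring⟩ := exists_criticalRing_eq_setOf_pow_eq hm ht
  exact hring ▸ existsUnique_pow_eq_mem_angularSector (mul_ne_zero two_ne_zero hm) hc α

end CriticalRing

section CriticalParams

/-- Half the derivative of `t ↦ |s + t p|²`. Its sign at `t ∈ criticalParams p s` tells whether the
ray leaves or enters the unit disc, and decides the type of the zeros in `criticalRing m p s t`. -/
noncomputable def rayNormSlope (p s : ℂ) (t : ℝ) : ℝ :=
  ‖p‖ ^ 2 * t + (conj p * s).re

variable {p s : ℂ} {t : ℝ}

theorem rayNormSlope_eq_re (p s : ℂ) (t : ℝ) : rayNormSlope p s t = (conj p * (s + t * p)).re := by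
  rw [rayNormSlope, mul_add, add_re, mul_left_comm, conj_mul', re_ofReal_mul, ← ofReal_pow,
    ofReal_re]
  ring

/- Completing the square: `quadForm` is a quarter of the discriminant of the quadratic equation
`|s + t p|² = 1` in `t`. -/
theorem norm_sq_mul_norm_add_mul_sq_sub_one (p s : ℂ) (t : ℝ) :
    ‖p‖ ^ 2 * (‖s + t * p‖ ^ 2 - 1) =
      rayNormSlope p s t ^ 2 - quadForm s.re s.im p.re p.im := by
  rw [rayNormSlope_eq_re, quadForm, ← normSq_eq_norm_sq, ← normSq_eq_norm_sq]
  simp only [normSq_apply, mul_re, mul_im, add_re, add_im, conj_re, conj_im, ofReal_re, ofReal_im]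
  ring

theorem mem_criticalParams_iff (hp : p ≠ 0) :
    t ∈ criticalParams p s ↔ 0 < t ∧ rayNormSlope p s t ^ 2 = quadForm s.re s.im p.re p.im := by
  refine and_congr_right fun _ => ?_
  rw [← sub_eq_zero (b := quadForm _ _ _ _), ← norm_sq_mul_norm_add_mul_sq_sub_one, mul_eq_zero,
    or_iff_right (pow_ne_zero 2 (norm_ne_zero_iff.2 hp)), sub_eq_zero,
    pow_eq_one_iff_of_nonneg (norm_nonneg _) two_ne_zero]

theorem rayNormSlope_eq_iff (hp : p ≠ 0) {c : ℝ} :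
    rayNormSlope p s t = c ↔ t = (c - (conj p * s).re) / ‖p‖ ^ 2 := by
  rw [rayNormSlope, ← eq_sub_iff_add_eq, eq_div_iff (pow_ne_zero 2 (norm_ne_zero_iff.2 hp)),
    mul_comm]

theorem ne_zero_of_re_conj_mul_neg (hb : (conj p * s).re < 0) : p ≠ 0 := by
  rintro rfl
  simp at hb

theorem criticalParams_eq_empty (hs : 1 < ‖s‖)
    (h : 0 ≤ (conj p * s).re ∨ quadForm s.re s.im p.re p.im < 0) : criticalParams p s = ∅ := by
  refine Set.eq_empty_iff_forall_notMem.2 fun t ⟨ht, hnorm⟩ => ?_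
  obtain hb | hQ := h
  · have expand : ‖s + t * p‖ ^ 2 = ‖s‖ ^ 2 + 2 * t * (conj p * s).re + (t * ‖p‖) ^ 2 := by
      rw [mul_pow, ← normSq_eq_norm_sq, ← normSq_eq_norm_sq, ← normSq_eq_norm_sq]
      simp only [normSq_apply, mul_re, mul_im, add_re, add_im, conj_re, conj_im, ofReal_re,
        ofReal_im]
      ring
    rw [hnorm] at expand
    nlinarith [mul_nonneg ht.le hb, sq_nonneg (t * ‖p‖)]
  · have hslope := norm_sq_mul_norm_add_mul_sq_sub_one p s t
    rw [hnorm, one_pow, sub_self, mul_zero] at hslope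
    linarith [sq_nonneg (rayNormSlope p s t)]

theorem exists_criticalParams_eq_singleton (hb : (conj p * s).re < 0)
    (hQ : quadForm s.re s.im p.re p.im = 0) :
    ∃ t, rayNormSlope p s t = 0 ∧ criticalParams p s = {t} := by
  have hp := ne_zero_of_re_conj_mul_neg hb
  refine ⟨_, (rayNormSlope_eq_iff hp).2 rfl, Set.ext fun t => ?_⟩
  rw [mem_criticalParams_iff hp, hQ, sq_eq_zero_iff, rayNormSlope_eq_iff hp, Set.mem_singleton_iff,
    and_iff_right_iff_imp]
  rintro rfl
  exact div_pos (by linarith) (pow_pos (norm_pos_iff.2 hp) 2)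

theorem exists_criticalParams_eq_pair (hs : 1 < ‖s‖) (hb : (conj p * s).re < 0)
    (hQ : 0 < quadForm s.re s.im p.re p.im) :
    ∃ t₁ t₂, rayNormSlope p s t₁ < 0 ∧ 0 < rayNormSlope p s t₂ ∧
      criticalParams p s = {t₁, t₂} := by
  have hp := ne_zero_of_re_conj_mul_neg hb
  have norm_sq_pos : 0 < ‖p‖ ^ 2 := pow_pos (norm_pos_iff.2 hp) 2
  set q := √(quadForm s.re s.im p.re p.im)
  have hq_pos : 0 < q := Real.sqrt_pos.2 hQ
  have hq_sq : q ^ 2 = quadForm s.re s.im p.re p.im := Real.sq_sqrt hQ.le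
  have hq_lt : q < -(conj p * s).re := by
    have at_zero := norm_sq_mul_norm_add_mul_sq_sub_one p s 0
    rw [ofReal_zero, zero_mul, add_zero, rayNormSlope, mul_zero, zero_add, ← hq_sq] at at_zero
    have := mul_pos norm_sq_pos (sub_pos.2 (one_lt_pow₀ hs two_ne_zero))
    exact lt_of_pow_lt_pow_left₀ 2 (by linarith) (by linarith)
  refine ⟨_, _, ((rayNormSlope_eq_iff hp).2 rfl).trans_lt (neg_lt_zero.2 hq_pos),
    hq_pos.trans_eq ((rayNormSlope_eq_iff hp).2 rfl).symm, Set.ext fun t => ?_⟩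
  rw [mem_criticalParams_iff hp, ← hq_sq, sq_eq_sq_iff_eq_or_eq_neg, or_comm,
    rayNormSlope_eq_iff hp, rayNormSlope_eq_iff hp, Set.mem_insert_iff, Set.mem_singleton_iff,
    and_iff_right_iff_imp]
  rintro (rfl | rfl)
  · exact div_pos (by linarith) norm_sq_pos
  · exact div_pos (by linarith) norm_sq_pos

end CriticalParams

section RingType

variable {m : ℕ} {p s z : ℂ} {t : ℝ}

theorem re_mul_conj_phase_of_mem_criticalRing (ht : t ∈ criticalParams p s)
    (hz : z ∈ criticalRing m p s t) :
    (s * conj (phase m z)).re = 1 - t * rayNormSlope p s t := by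
  have expand : s * conj (phase m z) =
      (‖s + t * p‖ : ℂ) ^ 2 - t * conj (conj p * (s + t * p)) := by
    rw [← mul_conj', hz.2, map_mul, conj_conj]
    ring
  rw [expand, ht.2, rayNormSlope_eq_re, ofReal_one, one_pow, sub_re, one_re, re_ofReal_mul, conj_re]

theorem isSaddle_iff_of_mem_criticalRing (hm : m ≠ 0) (ht : t ∈ criticalParams p s)
    (hz : z ∈ criticalRing m p s t) :
    IsSaddle (equivariantField m p s) z ↔ 0 < rayNormSlope p s t := by
  rw [isSaddle_equivariantField_iff hm (ne_zero_of_mem_criticalRing ht.1 hz)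
    (equivariantField_eq_zero_of_mem_criticalRing ht.1 hz),
    re_mul_conj_phase_of_mem_criticalRing ht hz, sub_lt_self_iff, mul_pos_iff_of_pos_left ht.1]

theorem hasPoincareIndex_one_iff_of_mem_criticalRing (hm : m ≠ 0) (ht : t ∈ criticalParams p s)
    (hz : z ∈ criticalRing m p s t) (hne : rayNormSlope p s t ≠ 0) :
    HasPoincareIndex (equivariantField m p s) z 1 ↔ rayNormSlope p s t < 0 := by
  have hre := re_mul_conj_phase_of_mem_criticalRing ht hz
  rw [hasPoincareIndex_equivariantField_one_iff hm (ne_zero_of_mem_criticalRing ht.1 hz)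
    (equivariantField_eq_zero_of_mem_criticalRing ht.1 hz), hre, lt_sub_comm,
    sub_self, ← neg_pos, ← mul_neg, mul_pos_iff_of_pos_left ht.1, neg_pos]
  rw [hre, Ne, sub_eq_self]
  exact mul_ne_zero ht.1.ne' hne

theorem isJacobianEigenvalue_zero_of_mem_criticalRing (ht : t ∈ criticalParams p s)
    (h : rayNormSlope p s t = 0) (hz : z ∈ criticalRing m p s t) :
    IsJacobianEigenvalue (equivariantField m p s) z 0 := by
  refine isJacobianEigenvalue_equivariantField_zero (ne_zero_of_mem_criticalRing ht.1 hz)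
    (equivariantField_eq_zero_of_mem_criticalRing ht.1 hz) ?_
  rw [re_mul_conj_phase_of_mem_criticalRing ht hz, h, mul_zero, sub_zero]

theorem isSaddleNode_iff_of_mem_criticalRing (hm : m ≠ 0) (hs : 1 < ‖s‖)
    (hb : (conj p * s).re < 0) (ht : t ∈ criticalParams p s) (h : rayNormSlope p s t = 0)
    (hz : z ∈ criticalRing m p s t) :
    IsSaddleNode (equivariantField m p s) z ↔
      p.re ^ 2 * s.re + m * p.im ^ 2 * s.re - (m - 1) * p.re * p.im * s.im ≠ 0 := by
  have hre := re_mul_conj_phase_of_mem_criticalRing ht hz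
  rw [h, mul_zero, sub_zero] at hre
  have norm_sq_ne : ‖p‖ ^ 2 ≠ 0 :=
    pow_ne_zero 2 (norm_ne_zero_iff.2 (ne_zero_of_re_conj_mul_neg hb))
  have scaled_trace : ‖p‖ ^ 2 * (s.re + (m - 1) * (phase m z).re) =
      p.re ^ 2 * s.re + m * p.im ^ 2 * s.re - (m - 1) * p.re * p.im * s.im := by
    rw [rayNormSlope, ← normSq_eq_norm_sq] at h
    rw [← normSq_eq_norm_sq, hz.2]
    simp only [normSq_apply, mul_re, add_re, conj_re, conj_im, ofReal_re, ofReal_im] at h ⊢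
    linear_combination (m - 1) * p.re * h
  rw [isSaddleNode_equivariantField_iff hm (ne_zero_of_mem_criticalRing ht.1 hz)
    (equivariantField_eq_zero_of_mem_criticalRing ht.1 hz) hre hs, ← scaled_trace,
    mul_ne_zero_iff, and_iff_right norm_sq_ne]

theorem hasPoincareIndex_zero_of_mem_criticalRing (hm : m ≠ 0) (ht : criticalParams p s = {t})
    (h : rayNormSlope p s t = 0) (hz : z ∈ criticalRing m p s t) :
    HasPoincareIndex (equivariantField m p s) z 0 := by
  have ht' : t ∈ criticalParams p s := ht ▸ Set.mem_singleton t
  have hre := re_mul_conj_phase_of_mem_criticalRing ht' hz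
  rw [h, mul_zero, sub_zero] at hre
  have finite_zeros : (equivariantZeros m p s).Finite := by
    rw [equivariantZeros_eq_insert_iUnion, ht, Set.biUnion_singleton]
    exact (finite_criticalRing hm ht').insert 0
  exact hasPoincareIndex_equivariantField_zero (ne_zero_of_mem_criticalRing ht'.1 hz)
    (equivariantField_eq_zero_of_mem_criticalRing ht'.1 hz) hre
    (nhdsNE_le_cofinite z finite_zeros.compl_mem_cofinite)

end RingType

section Classification

variable {m : ℕ} {p s : ℂ} {t t₁ t₂ : ℝ}

theorem equivariantZeros_eq_singleton (m : ℕ) (hs : 1 < ‖s‖)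
    (h : 0 ≤ (conj p * s).re ∨ quadForm s.re s.im p.re p.im < 0) :
    equivariantZeros m p s = {0} := by
  rw [equivariantZeros_eq_insert_iUnion, criticalParams_eq_empty hs h, Set.biUnion_empty,
    insert_empty_eq]

theorem equivariantZeros_eq_insert_criticalRing (m : ℕ) (ht : criticalParams p s = {t}) :
    equivariantZeros m p s = insert 0 (criticalRing m p s t) := by
  rw [equivariantZeros_eq_insert_iUnion, ht, Set.biUnion_singleton]

theorem equivariantZeros_eq_insert_union (m : ℕ) (ht : criticalParams p s = {t₁, t₂}) :
    equivariantZeros m p s = insert 0 (criticalRing m p s t₁ ∪ criticalRing m p s t₂) := by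
  rw [equivariantZeros_eq_insert_iUnion, ht, Set.biUnion_pair]

theorem setOf_isSaddle_eq_criticalRing (hm : m ≠ 0) (h₁ : rayNormSlope p s t₁ < 0)
    (h₂ : 0 < rayNormSlope p s t₂) (ht : criticalParams p s = {t₁, t₂}) :
    {z | z ∈ equivariantZeros m p s ∧ z ≠ 0 ∧ IsSaddle (equivariantField m p s) z} =
      criticalRing m p s t₂ := by
  have ht₁ : t₁ ∈ criticalParams p s := ht ▸ Set.mem_insert _ _
  have ht₂ : t₂ ∈ criticalParams p s := ht ▸ Set.mem_insert_of_mem _ rfl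
  rw [equivariantZeros_eq_insert_union m ht]
  ext z
  constructor
  · rintro ⟨rfl | hz | hz, hz₀, hsaddle⟩
    · exact absurd rfl hz₀
    · exact absurd ((isSaddle_iff_of_mem_criticalRing hm ht₁ hz).1 hsaddle) h₁.not_gt
    · exact hz
  · exact fun hz => ⟨.inr (.inr hz), ne_zero_of_mem_criticalRing ht₂.1 hz,
      (isSaddle_iff_of_mem_criticalRing hm ht₂ hz).2 h₂⟩

theorem setOf_hasPoincareIndex_one_eq_criticalRing (hm : m ≠ 0) (h₁ : rayNormSlope p s t₁ < 0)
    (h₂ : 0 < rayNormSlope p s t₂) (ht : criticalParams p s = {t₁, t₂}) :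
    {z | z ∈ equivariantZeros m p s ∧ z ≠ 0 ∧ HasPoincareIndex (equivariantField m p s) z 1} =
      criticalRing m p s t₁ := by
  have ht₁ : t₁ ∈ criticalParams p s := ht ▸ Set.mem_insert _ _
  have ht₂ : t₂ ∈ criticalParams p s := ht ▸ Set.mem_insert_of_mem _ rfl
  rw [equivariantZeros_eq_insert_union m ht]
  ext z
  constructor
  · rintro ⟨rfl | hz | hz, hz₀, hindex⟩
    · exact absurd rfl hz₀
    · exact hz
    · exact absurd ((hasPoincareIndex_one_iff_of_mem_criticalRing hm ht₂ hz h₂.ne').1 hindex)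
        h₂.not_gt
  · exact fun hz => ⟨.inr (.inl hz), ne_zero_of_mem_criticalRing ht₁.1 hz,
      (hasPoincareIndex_one_iff_of_mem_criticalRing hm ht₁ hz h₁.ne).2 h₁⟩

theorem existsUnique_mem_angularSector_of_setOf_eq_criticalRing {P : ℂ → Prop} (hm : m ≠ 0)
    (ht : t ∈ criticalParams p s)
    (h : {z | z ∈ equivariantZeros m p s ∧ z ≠ 0 ∧ P z} = criticalRing m p s t) (α : ℝ) :
    ∃! z, z ∈ equivariantZeros m p s ∧ z ∈ angularSector (2 * m) α ∧ P z := by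
  refine (existsUnique_congr fun z => ?_).1
    (existsUnique_mem_criticalRing_mem_angularSector hm ht α)
  rw [← h, Set.mem_ofPred_eq]
  have := ne_zero_of_mem_angularSector (n := 2 * m) (z := z) (α := α)
  tauto

theorem ncard_equivariantZeros_of_eq_singleton (hm : m ≠ 0) (ht : criticalParams p s = {t}) :
    (equivariantZeros m p s).ncard = 2 * m + 1 := by
  have ht_mem : t ∈ criticalParams p s := ht ▸ Set.mem_singleton t
  rw [equivariantZeros_eq_insert_criticalRing m ht,
    Set.ncard_insert_of_notMem (zero_notMem_criticalRing ht_mem.1) (finite_criticalRing hm ht_mem),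
    ncard_criticalRing hm ht_mem]

theorem ncard_equivariantZeros_of_eq_pair (hm : m ≠ 0) (hne : t₁ ≠ t₂)
    (ht : criticalParams p s = {t₁, t₂}) : (equivariantZeros m p s).ncard = 4 * m + 1 := by
  have ht₁ : t₁ ∈ criticalParams p s := ht ▸ Set.mem_insert _ _
  have ht₂ : t₂ ∈ criticalParams p s := ht ▸ Set.mem_insert_of_mem _ rfl
  have fin₁ := finite_criticalRing hm ht₁
  have fin₂ := finite_criticalRing hm ht₂
  have zero_notMem : (0 : ℂ) ∉ criticalRing m p s t₁ ∪ criticalRing m p s t₂ := fun h =>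
    h.elim (zero_notMem_criticalRing ht₁.1) (zero_notMem_criticalRing ht₂.1)
  rw [equivariantZeros_eq_insert_union m ht,
    Set.ncard_insert_of_notMem zero_notMem (fin₁.union fin₂),
    Set.ncard_union_eq (disjoint_criticalRing hne) fin₁ fin₂, ncard_criticalRing hm ht₁,
    ncard_criticalRing hm ht₂]
  ring

theorem existsUnique_mem_equivariantZeros_mem_angularSector (hm : m ≠ 0)
    (ht : criticalParams p s = {t}) (α : ℝ) :
    ∃! z, z ∈ equivariantZeros m p s ∧ z ∈ angularSector (2 * m) α := by
  refine (existsUnique_congr fun z => and_congr_left fun hz => ?_).1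
    (existsUnique_mem_criticalRing_mem_angularSector hm (ht ▸ Set.mem_singleton t) α)
  rw [equivariantZeros_eq_insert_criticalRing m ht, Set.mem_insert_iff,
    or_iff_right (ne_zero_of_mem_angularSector hz)]

theorem lemma3p4_general (hm : m ≠ 0) (hs : 1 < ‖s‖) :
    (0 ≤ (conj p * s).re ∨ quadForm s.re s.im p.re p.im < 0 → equivariantZeros m p s = {0}) ∧
    ((conj p * s).re < 0 →
      (quadForm s.re s.im p.re p.im = 0 →
        0 ∈ equivariantZeros m p s ∧
        (equivariantZeros m p s).ncard = 2 * m + 1 ∧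
        (∀ α : ℝ, ∃! z, z ∈ equivariantZeros m p s ∧ z ∈ angularSector (2 * m) α) ∧
        ∀ z ∈ equivariantZeros m p s, z ≠ 0 →
          IsJacobianEigenvalue (equivariantField m p s) z 0 ∧
          HasPoincareIndex (equivariantField m p s) z 0 ∧
          (IsSaddleNode (equivariantField m p s) z ↔
            p.re ^ 2 * s.re + m * p.im ^ 2 * s.re - (m - 1) * p.re * p.im * s.im ≠ 0)) ∧
      (0 < quadForm s.re s.im p.re p.im →
        0 ∈ equivariantZeros m p s ∧
        (equivariantZeros m p s).ncard = 4 * m + 1 ∧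
        {z | z ∈ equivariantZeros m p s ∧ z ≠ 0 ∧
          IsSaddle (equivariantField m p s) z}.ncard = 2 * m ∧
        {z | z ∈ equivariantZeros m p s ∧ z ≠ 0 ∧
          HasPoincareIndex (equivariantField m p s) z 1}.ncard = 2 * m ∧
        (∀ z ∈ equivariantZeros m p s, z ≠ 0 →
          IsSaddle (equivariantField m p s) z ∨
          HasPoincareIndex (equivariantField m p s) z 1) ∧
        ∀ α : ℝ,
          (∃! z, z ∈ equivariantZeros m p s ∧ z ∈ angularSector (2 * m) α ∧
            IsSaddle (equivariantField m p s) z) ∧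
          (∃! z, z ∈ equivariantZeros m p s ∧ z ∈ angularSector (2 * m) α ∧
            HasPoincareIndex (equivariantField m p s) z 1))) := by
  refine ⟨equivariantZeros_eq_singleton m hs, fun hb => ⟨fun hQ => ?_, fun hQ => ?_⟩⟩
  · obtain ⟨t, hslope, ht⟩ := exists_criticalParams_eq_singleton hb hQ
    have ht_mem : t ∈ criticalParams p s := ht ▸ Set.mem_singleton t
    refine ⟨zero_mem_equivariantZeros, ncard_equivariantZeros_of_eq_singleton hm ht,
      existsUnique_mem_equivariantZeros_mem_angularSector hm ht, fun z hzero hz₀ => ?_⟩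
    rw [equivariantZeros_eq_insert_criticalRing m ht] at hzero
    have hz : z ∈ criticalRing m p s t := hzero.resolve_left hz₀
    exact ⟨isJacobianEigenvalue_zero_of_mem_criticalRing ht_mem hslope hz,
      hasPoincareIndex_zero_of_mem_criticalRing hm ht hslope hz,
      isSaddleNode_iff_of_mem_criticalRing hm hs hb ht_mem hslope hz⟩
  · obtain ⟨t₁, t₂, h₁, h₂, ht⟩ := exists_criticalParams_eq_pair hs hb hQ
    have ht₁ : t₁ ∈ criticalParams p s := ht ▸ Set.mem_insert _ _
    have ht₂ : t₂ ∈ criticalParams p s := ht ▸ Set.mem_insert_of_mem _ rfl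
    have saddles_eq := setOf_isSaddle_eq_criticalRing hm h₁ h₂ ht
    have index_one_eq := setOf_hasPoincareIndex_one_eq_criticalRing hm h₁ h₂ ht
    refine ⟨zero_mem_equivariantZeros,
      ncard_equivariantZeros_of_eq_pair hm (fun h => (h ▸ h₁).not_gt h₂) ht,
      saddles_eq ▸ ncard_criticalRing hm ht₂, index_one_eq ▸ ncard_criticalRing hm ht₁,
      fun z hzero hz₀ => ?_, fun α =>
      ⟨existsUnique_mem_angularSector_of_setOf_eq_criticalRing hm ht₂ saddles_eq α,
        existsUnique_mem_angularSector_of_setOf_eq_criticalRing hm ht₁ index_one_eq α⟩⟩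
    rw [equivariantZeros_eq_insert_union m ht] at hzero
    obtain hz | hz := hzero.resolve_left hz₀
    · exact .inr (index_one_eq.ge hz).2.2
    · exact .inl (saddles_eq.ge hz).2.2

theorem quadForm_neg_of_re_conj_mul_neg (hs : 1 < |s.im|) (hps : 0 ≤ p.im * s.im)
    (hb : (conj p * s).re < 0) : quadForm s.re s.im p.re p.im < 0 := by
  have hs_sq := (one_lt_sq_iff_one_lt_abs s.im).2 hs
  have hp := normSq_pos.2 (ne_zero_of_re_conj_mul_neg hb)
  simp only [mul_re, conj_re, conj_im, normSq_apply] at hb hp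
  have cross : 0 ≤ p.im * s.im * -(p.re * s.re + p.im * s.im) := mul_nonneg hps (by linarith)
  have norm_part : 0 < (p.re ^ 2 + p.im ^ 2) * (s.im ^ 2 - 1) :=
    mul_pos (by linarith) (by linarith)
  rw [quadForm]
  linarith [sq_nonneg (p.im * s.re), sq_nonneg (p.im * s.im)]

theorem re_conj_mul_neg_of_quadForm_nonneg (hs : 1 < |s.im|) (hps : p.im * s.im < 0)
    (hQ : 0 ≤ quadForm s.re s.im p.re p.im) : (conj p * s).re < 0 := by
  have hs_sq := (one_lt_sq_iff_one_lt_abs s.im).2 hs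
  rw [quadForm] at hQ
  simp only [mul_re, conj_re, conj_im]
  by_contra! hb
  have cross : 0 ≤ -(p.im * s.im) * (p.re * s.re + p.im * s.im) :=
    mul_nonneg (by linarith) (by linarith)
  have hp_im : 0 < p.im ^ 2 := sq_pos_of_ne_zero (left_ne_zero_of_mul hps.ne)
  have im_part : 0 < p.im ^ 2 * (s.im ^ 2 - 1) := mul_pos hp_im (by linarith)
  have re_part : 0 ≤ p.re ^ 2 * (s.im ^ 2 - 1) := mul_nonneg (sq_nonneg _) (by linarith)
  linarith [sq_nonneg (p.im * s.re), sq_nonneg (p.im * s.im)]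

end Classification

theorem lemma3p4 (p₁ p₂ s₁ s₂ : ℝ) :
    quadForm s₁ s₂ p₁ p₂ =
      (1 - s₂ ^ 2) * p₁ ^ 2 + (1 - s₁ ^ 2) * p₂ ^ 2 + 2 * s₁ * s₂ * p₁ * p₂ ∧
    ((1 < s₂ ∧ 0 ≤ p₂) ∨ (s₂ < -1 ∧ p₂ ≤ 0) → criticalPoints p₁ p₂ s₁ s₂ = {0}) ∧
    ((1 < s₂ ∧ p₂ < 0) ∨ (s₂ < -1 ∧ 0 < p₂) →
      (quadForm s₁ s₂ p₁ p₂ < 0 → criticalPoints p₁ p₂ s₁ s₂ = {0}) ∧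
      (quadForm s₁ s₂ p₁ p₂ = 0 →
        0 ∈ criticalPoints p₁ p₂ s₁ s₂ ∧
        (criticalPoints p₁ p₂ s₁ s₂).ncard = 13 ∧
        (∀ α : ℝ, ∃! z : ℂ, z ∈ criticalPoints p₁ p₂ s₁ s₂ ∧ z ∈ sector α) ∧
        ∀ z ∈ criticalPoints p₁ p₂ s₁ s₂, z ≠ 0 →
          IsJacobianEigenvalue (planarField p₁ p₂ s₁ s₂) z 0 ∧
          HasPoincareIndex (planarField p₁ p₂ s₁ s₂) z 0 ∧
          (IsSaddleNode (planarField p₁ p₂ s₁ s₂) z ↔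
            p₁ ^ 2 * s₁ + 6 * p₂ ^ 2 * s₁ - 5 * p₁ * p₂ * s₂ ≠ 0)) ∧
      (0 < quadForm s₁ s₂ p₁ p₂ →
        0 ∈ criticalPoints p₁ p₂ s₁ s₂ ∧
        (criticalPoints p₁ p₂ s₁ s₂).ncard = 25 ∧
        {z | z ∈ criticalPoints p₁ p₂ s₁ s₂ ∧ z ≠ 0 ∧
          IsSaddle (planarField p₁ p₂ s₁ s₂) z}.ncard = 12 ∧
        {z | z ∈ criticalPoints p₁ p₂ s₁ s₂ ∧ z ≠ 0 ∧
          HasPoincareIndex (planarField p₁ p₂ s₁ s₂) z 1}.ncard = 12 ∧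
        (∀ z ∈ criticalPoints p₁ p₂ s₁ s₂, z ≠ 0 →
          IsSaddle (planarField p₁ p₂ s₁ s₂) z ∨
          HasPoincareIndex (planarField p₁ p₂ s₁ s₂) z 1) ∧
        ∀ α : ℝ,
          (∃! z : ℂ, z ∈ criticalPoints p₁ p₂ s₁ s₂ ∧ z ∈ sector α ∧
            IsSaddle (planarField p₁ p₂ s₁ s₂) z) ∧
          (∃! z : ℂ, z ∈ criticalPoints p₁ p₂ s₁ s₂ ∧ z ∈ sector α ∧
            HasPoincareIndex (planarField p₁ p₂ s₁ s₂) z 1))) := by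
  set p : ℂ := ⟨p₁, p₂⟩
  set s : ℂ := ⟨s₁, s₂⟩
  have classification (hs : 1 < |s₂|) :=
    lemma3p4_general (p := p) (by decide : 6 ≠ 0) (hs.trans_le (abs_im_le_norm s))
  simp only [Nat.cast_ofNat, show (6 - 1 : ℝ) = 5 by norm_num] at classification
  rw [criticalPoints_eq_equivariantZeros, planarField_eq_equivariantField]
  simp only [sector_eq_angularSector]
  refine ⟨by rw [quadForm]; ring, fun h => ?_, fun h => ?_⟩
  · have hs : 1 < |s.im| := lt_abs.2 (h.imp And.left (lt_neg.1 ·.1))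
    have hps : 0 ≤ p.im * s.im := by obtain ⟨_, _⟩ | ⟨_, _⟩ := h <;> nlinarith
    exact (classification hs).1
      ((le_or_gt 0 _).imp_right (quadForm_neg_of_re_conj_mul_neg hs hps))
  · have hs : 1 < |s.im| := lt_abs.2 (h.imp And.left (lt_neg.1 ·.1))
    have hps : p.im * s.im < 0 := by obtain ⟨_, _⟩ | ⟨_, _⟩ := h <;> nlinarith
    have hb := re_conj_mul_neg_of_quadForm_nonneg (p := p) hs hps
    obtain ⟨only_origin, rings⟩ := classification hs
    exact ⟨fun hQ => only_origin (.inr hQ), fun hQ => (rings (hb hQ.ge)).1 hQ,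
      fun hQ => (rings (hb hQ.le)).2 hQ⟩
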